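/- Let $H$ be a complex Hilbert space (not necessarily separable), $L(H)$ the algebra of bounded operators on $H$, $\mathcal R\subseteq L(H)$ a set of pairwise commuting self-adjoint operators, and $K\in L(H)$ a density operator (positive, $\operatorname{Tr}K=1$) with normal state $\rho(A)=\operatorname{Tr}(KA)$. For $\mathcal F\subseteq L(H)$ let $\mathcal F'$ be its commutant and $\mathrm{vN}(\mathcal F)$ the smallest von Neumann algebra on $H$ containing $\mathcal F$. A norm-closed unital $*$-subalgebra $\mathcal B\subseteq L(H)$ is called $\mathcal R$-beable for $K$ if * (Beable) there is a Borel probability measure $\mu$ on the space of dispersion-free (that is, multiplicative) states $\omega$ of $\mathcal B$, with the topology of pointwise convergence, such that $\rho(A)=\int\omega(A)\,d\mu(\omega)$ for all $A\in\mathcal B$; * ($\mathcal R$-Priv) $\mathcal R\subseteq\mathcal B$; * (Def) $U\mathcal BU^*=\mathcal B$ for every unitary $U\in\mathcal R'$ that fixes $\rho$, i.e. $\rho(U^*AU)=\rho(A)$ for all $A\in L(H)$ (equivalently $UKU^*=K$). It is maximal $\mathcal R$-beable for $K$ if it is maximal under inclusion among the $\mathcal R$-beable algebras for $K$. Let $S=[\mathcal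 R''\,\overline{\operatorname{range}}(K)]$, the closed linear span of the vectors $Ax$ with $A\in\mathcal R''$ and $x\in\overline{\operatorname{range}}(K)$, and let $P_S$ be the orthogonal projection of $H$ onto $S$. Operators on $S$ and on $S^\perp$ are regarded as operators on $H$ by extending them by $0$. **Theorem.** $S$ is the smallest closed subspace of $H$ that contains $\operatorname{range}(K)$ and is invariant under every element of $\mathcal R$. Every maximal $\mathcal R$-beable algebra for $K$ has the form $L(S^\perp)\oplus\mathcal M$, where $\mathcal M$ is a $*$-algebra of operators with $$\mathrm{vN}(\mathcal R)P_S\subseteq\mathcal M\subseteq\mathrm{vN}(\mathcal R\cup\{K\})P_S$$ and $\mathcal M$ is maximal abelian in $\mathrm{vN}(\mathcal R\cup\{K\})P_S$ (maximal among the commutative $*$-subalgebras of it). Conversely, for every such $\mathcal M$, the set $L(S^\perp)\oplus\mathcal M$ is a maximal $\mathcal R$-beable algebra for $K$. -/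

import Mathlib

open scoped ComplexOrder

noncomputable section

namespace BeableAlgebra

/-! ### Beable subalgebras of a unital C⋆-algebra -/

section Abstract

variable {𝔄 : Type*} [CStarAlgebra 𝔄]

/-- The space of dispersion-free states of a unital ⋆-subalgebra `B`: positive functionals `ω` on
`B` with `ω 1 = 1` such that `ω (A X) = ω A * ω X` for all `A`, `X` in `B`. It carries the topology
of pointwise convergence. -/
def dispersionFreeStates (B : StarSubalgebra ℂ 𝔄) : Set (WeakDual ℂ B) :=
  {ω | (∀ A : B, 0 ≤ ω (star A * A)) ∧ ω 1 = 1 ∧ ∀ A X : B, ω (A * X) = ω A * ω X}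

/-- The Borel σ-algebra of the topology of pointwise convergence. -/
instance (B : StarSubalgebra ℂ 𝔄) : MeasurableSpace (dispersionFreeStates B) :=
  borel (dispersionFreeStates B)

/-- `B` is beable for the state `ρ`: the restriction of `ρ` to `B` is a mixture of dispersion-free
states of `B`. -/
def IsBeable (ρ : 𝔄 → ℂ) (B : StarSubalgebra ℂ 𝔄) : Prop :=
  ∃ μ : MeasureTheory.Measure (dispersionFreeStates B), MeasureTheory.IsProbabilityMeasure μ ∧
    ∀ A : B, ρ A = ∫ ω : dispersionFreeStates B, (ω : WeakDual ℂ B) A ∂μ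

/-- The unital C⋆-subalgebra `B` is `R`-beable for the state `ρ`. -/
structure IsRBeable (R : Set 𝔄) (ρ : 𝔄 → ℂ) (B : StarSubalgebra ℂ 𝔄) : Prop where
  /-- `B` is norm-closed, i.e. a C⋆-subalgebra. -/
  isClosed : IsClosed (B : Set 𝔄)
  /-- (Beable) -/
  beable : IsBeable ρ B
  /-- (`R`-Priv) -/
  priv : R ⊆ B
  /-- (Def): `B` is invariant under conjugation by unitaries in `R'` that fix `ρ`. -/
  definable : ∀ U ∈ unitary 𝔄, U ∈ Set.centralizer R → (∀ A, ρ (star U * A * U) = ρ A) →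
    (fun A => U * A * star U) '' (B : Set 𝔄) = B

/-- `B` is maximal among the `R`-beable C⋆-subalgebras for `ρ`. -/
def IsMaximalRBeable (R : Set 𝔄) (ρ : 𝔄 → ℂ) (B : StarSubalgebra ℂ 𝔄) : Prop :=
  Maximal (IsRBeable R ρ) B

end Abstract

/-! ### Normal states, generated von Neumann algebras and the form of the algebras -/

section Hilbert

variable {H : Type*} [NormedAddCommGroup H] [InnerProductSpace ℂ H] [CompleteSpace H]

/-- The trace, computed in a Hilbert basis of `H` (on trace-class operators, and on positive
operators, it does not depend on the basis; the series is `0` by convention if not summable). -/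
def trace (A : H →L[ℂ] H) : ℂ :=
  ∑' i : (exists_hilbertBasis ℂ H).choose,
    inner ℂ ((exists_hilbertBasis ℂ H).choose_spec.choose i)
      (A ((exists_hilbertBasis ℂ H).choose_spec.choose i))

/-- Density operators: positive operators of trace `1` (the diagonal series of such an operator is
summable, as otherwise `trace K` would be `0`). -/
def IsDensityOperator (K : H →L[ℂ] H) : Prop :=
  K.IsPositive ∧ trace K = 1

/-- The normal state `A ↦ Tr (K A)` of a density operator `K`. -/
def normalState (K : H →L[ℂ] H) (A : H →L[ℂ] H) : ℂ :=
  trace (K * A)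

/-- The smallest von Neumann algebra on `H` containing the set `F`, as a set of operators. -/
def vN (F : Set (H →L[ℂ] H)) : Set (H →L[ℂ] H) :=
  ⋂ V ∈ {V : VonNeumannAlgebra H | F ⊆ V}, (V : Set (H →L[ℂ] H))

/-- The closed linear span `[R'' range K]`. -/
def privSubspace (R : Set (H →L[ℂ] H)) (K : H →L[ℂ] H) : Submodule ℂ H :=
  (Submodule.span ℂ {y | ∃ A ∈ Set.centralizer (Set.centralizer R),
    ∃ x ∈ closure (Set.range K), y = A x}).topologicalClosure

instance (R : Set (H →L[ℂ] H)) (K : H →L[ℂ] H) : CompleteSpace (privSubspace R K) :=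
  (Submodule.isClosed_topologicalClosure _).completeSpace_coe

/-- The orthogonal projection `P_S` of `H` onto `S = [R'' range K]`. -/
def privProj (R : Set (H →L[ℂ] H)) (K : H →L[ℂ] H) : H →L[ℂ] H :=
  (privSubspace R K).starProjection

/-- `M` is maximal among the abelian ⋆-subalgebras contained in `W` (maximality makes `M` closed
when `W` is closed). -/
def IsMaximalAbelianIn (W : Set (H →L[ℂ] H)) (M : NonUnitalStarSubalgebra ℂ (H →L[ℂ] H)) : Prop :=
  Maximal (fun N : NonUnitalStarSubalgebra ℂ (H →L[ℂ] H) =>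
    (N : Set (H →L[ℂ] H)) ⊆ W ∧ ∀ A ∈ N, ∀ B ∈ N, A * B = B * A) M

/-- The conditions on the summand `M`, an algebra of operators on `S` (operators on `S` are
extended by `0` to operators on `H`): `vN(R) P_S ⊆ M ⊆ vN(R, K) P_S` and `M` is maximal abelian in
`vN(R, K) P_S`. -/
structure IsAdmissible (R : Set (H →L[ℂ] H)) (K : H →L[ℂ] H)
    (M : NonUnitalStarSubalgebra ℂ (H →L[ℂ] H)) : Prop where
  lower : (fun A => A * privProj R K) '' vN R ⊆ M
  upper : (M : Set (H →L[ℂ] H)) ⊆ (fun A => A * privProj R K) '' vN (insert K R)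
  maximalAbelian : IsMaximalAbelianIn ((fun A => A * privProj R K) '' vN (insert K R)) M

/-- `L(S^⊥) ⊕ M`, as a set of operators on `H`; the elements of `L(S^⊥)`, extended by `0`, are the
operators `(1 - P_S) C (1 - P_S)` with `C` a bounded operator on `H`. -/
def directSum (R : Set (H →L[ℂ] H)) (K : H →L[ℂ] H)
    (M : NonUnitalStarSubalgebra ℂ (H →L[ℂ] H)) : Set (H →L[ℂ] H) :=
  {X | ∃ C : H →L[ℂ] H, ∃ A ∈ M, X = (1 - privProj R K) * C * (1 - privProj R K) + A}

end Hilbert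

end BeableAlgebra

end

open scoped ComplexOrder InnerProductSpace

namespace BeableAlgebra

variable {H : Type*} [NormedAddCommGroup H] [InnerProductSpace ℂ H] [CompleteSpace H]

/-! ### Density operators and normal states -/

section Trace

open ContinuousLinearMap

/-! Write `p` for the projection onto `S`, `W = R ∪ {K}` and `ρ` for the normal state. Testing `ρ`
on rank-one operators recovers `K`, so the unitaries occurring in (Def) are exactly those of `W'`
(`normalState_conj_unitary`, `commute_of_normalState_conj`).

Let `B` be `R`-beable. Dispersion-free states kill commutators, so `ρ` vanishes on `|[A, X] Y|²` for
`A`, `X`, `Y` in `B`, which forces `[A, X] Y K = 0`. Since `R ⊆ B`, the common kernel of all `[A, X]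
Y` is a closed `R`-invariant subspace containing the range of `K`, hence contains `S`: `B` is
commutative on `S` (`commutator_mul_privProj`). Averaging over the unitaries `p + z(1 - p)` of `W'`
puts `p A (1 - p)` into `B`, and commutativity on `S` makes it vanish, so `p` reduces `B`
(`mul_privProj_comm`). For self-adjoint `A` in `B`, `A p` commutes with all its conjugates by
unitaries of `W'`; differentiating along one-parameter groups and using a derivation argument gives
`A p ∈ W''` (`mul_privProj_mem`). Thus `B p` is an abelian ⋆-subalgebra of `vN(W) p`.

Conversely, let `M` be admissible. Conjugation by `W'` fixes `M ⊆ W''` pointwise, and compression to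
`S` maps `L(S^⊥) ⊕ M` onto a commutative C⋆-algebra through which `ρ` factors. By Gelfand duality
and Riesz–Markov, states of the latter are mixtures of characters, so the sum is `R`-beable
(`isRBeable_reducedSum`).

Both directions of the theorem follow by playing the two maximalities against each other: Zorn's
lemma puts `B p` inside a maximal abelian `M`, which is automatically admissible, and `B ⊆ L(S^⊥) ⊕
M`. -/

omit [CompleteSpace H] in
theorem hasSum_norm_inner_sq {ι : Type*} (b : HilbertBasis ι ℂ H) (x : H) :
    HasSum (fun i => ‖⟪b i, x⟫_ℂ‖ ^ 2) (‖x‖ ^ 2) := by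
  have h := Complex.hasSum_re (b.hasSum_inner_mul_inner x x)
  rw [inner_self_eq_norm_sq_to_K] at h
  convert h using 1
  · ext i
    rw [← inner_conj_symm x (b i), mul_comm, Complex.mul_conj, Complex.normSq_eq_norm_sq]
    norm_cast
  · norm_cast

omit [CompleteSpace H] in
theorem summable_norm_inner_sq {ι κ : Type*} (b : HilbertBasis ι ℂ H) (c : HilbertBasis κ ℂ H)
    {T : H →L[ℂ] H} (hT : Summable fun i => ‖T (b i)‖ ^ 2) :
    Summable fun p : ι × κ => ‖⟪c p.2, T (b p.1)⟫_ℂ‖ ^ 2 := by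
  rw [summable_prod_of_nonneg fun p => sq_nonneg _]
  refine ⟨fun i => (hasSum_norm_inner_sq c (T (b i))).summable, ?_⟩
  simpa only [(hasSum_norm_inner_sq c _).tsum_eq] using hT

/-- The matrix of the adjoint is the conjugate transpose, so summing the squared entries by columns
instead of rows gives both adjoint invariance and basis independence of the Hilbert–Schmidt
condition. -/
theorem summable_norm_adjoint_sq {ι κ : Type*} (b : HilbertBasis ι ℂ H) (c : HilbertBasis κ ℂ H)
    {T : H →L[ℂ] H} (hT : Summable fun i => ‖T (b i)‖ ^ 2) :
    Summable fun j => ‖star T (c j)‖ ^ 2 := by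
  have h := (summable_norm_inner_sq b c hT).prod_symm
  rw [summable_prod_of_nonneg fun p => sq_nonneg _] at h
  refine h.2.congr fun j => ?_
  rw [← (hasSum_norm_inner_sq b (star T (c j))).tsum_eq]
  refine tsum_congr fun i => ?_
  rw [star_eq_adjoint, adjoint_inner_right, norm_inner_symm]
  rfl

/-- The trace of `L * L * A`, with `L` a self-adjoint Hilbert–Schmidt operator, is the sum of the
vector functionals of the vectors `L (c j)`, whatever the two bases. -/
theorem exists_hasSum_trace {ι κ : Type*} (b : HilbertBasis ι ℂ H) (c : HilbertBasis κ ℂ H)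
    {L : H →L[ℂ] H} (hL : IsSelfAdjoint L) (hs : Summable fun i => ‖L (b i)‖ ^ 2)
    (A : H →L[ℂ] H) :
    ∃ t : ℂ, HasSum (fun i => ⟪b i, (L * L * A) (b i)⟫_ℂ) t ∧
      HasSum (fun j => ⟪L (c j), A (L (c j))⟫_ℂ) t := by
  have hsymm : ∀ x y, ⟪L x, y⟫_ℂ = ⟪x, L y⟫_ℂ := fun x y => hL.isSymmetric x y
  have h1 : Summable fun i => ‖(star A * L) (b i)‖ ^ 2 := by
    refine Summable.of_nonneg_of_le (fun i => sq_nonneg _) (fun i => ?_)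
      (hs.mul_left (‖star A‖ ^ 2))
    rw [← mul_pow]
    gcongr
    exact (star A).le_opNorm _
  have h2 : Summable fun i => ‖(L * A) (b i)‖ ^ 2 := by
    simpa [hL.star_eq] using summable_norm_adjoint_sq b b h1
  -- Both `L` and `L * A` are Hilbert–Schmidt, so this double series converges absolutely. By
  -- Parseval, its sums over `κ` and over `ι` produce the two single series.
  have hF : Summable fun p : ι × κ => ⟪L (b p.1), c p.2⟫_ℂ * ⟪c p.2, (L * A) (b p.1)⟫_ℂ := by
    refine Summable.of_norm_bounded
      ((summable_norm_inner_sq b c hs).add (summable_norm_inner_sq b c h2)) fun p => ?_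
    rw [norm_mul, norm_inner_symm]
    nlinarith [sq_nonneg (‖⟪c p.2, L (b p.1)⟫_ℂ‖ - ‖⟪c p.2, (L * A) (b p.1)⟫_ℂ‖),
      norm_nonneg ⟪c p.2, L (b p.1)⟫_ℂ, norm_nonneg ⟪c p.2, (L * A) (b p.1)⟫_ℂ]
  obtain ⟨t, ht⟩ := hF
  refine ⟨t, ?_, ?_⟩
  · convert ht.prod_fiberwise fun i => c.hasSum_inner_mul_inner (L (b i)) ((L * A) (b i)) using 2
    simp only [mul_apply_eq_comp, hsymm]
  · refine ((Equiv.prodComm κ ι).hasSum_iff.2 ht).prod_fiberwise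
      (g := fun j => ⟪L (c j), A (L (c j))⟫_ℂ) fun j => ?_
    rw [← adjoint_inner_left]
    refine (b.hasSum_inner_mul_inner (adjoint A (L (c j))) (L (c j))).congr_fun fun i => ?_
    simp only [Function.comp_apply, Equiv.prodComm_apply, Prod.fst_swap, Prod.snd_swap,
      mul_apply_eq_comp]
    rw [hsymm, ← hsymm (c j), adjoint_inner_left, mul_comm]

/-- The Hilbert basis in which `trace` is computed. -/
noncomputable def traceBasis : HilbertBasis (exists_hilbertBasis ℂ H).choose ℂ H :=
  (exists_hilbertBasis ℂ H).choose_spec.choose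

theorem trace_eq (A : H →L[ℂ] H) : trace A = ∑' i, ⟪traceBasis i, A (traceBasis i)⟫_ℂ := rfl

variable {K : H →L[ℂ] H}

theorem IsDensityOperator.isSelfAdjoint (hK : IsDensityOperator K) : IsSelfAdjoint K :=
  hK.1.isSelfAdjoint

/-- The diagonal entries of `K = L * L` are `‖L bᵢ‖²`, so `L` is Hilbert–Schmidt. This turns the
normal state into a sum of vector functionals, from which linearity, positivity and faithfulness on
the range of `K` are read off. -/
theorem IsDensityOperator.exists_sqrt (hK : IsDensityOperator K) :
    ∃ L : H →L[ℂ] H, IsSelfAdjoint L ∧ L * L = K ∧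
      Summable fun i => ‖L (traceBasis (H := H) i)‖ ^ 2 := by
  have hK0 : 0 ≤ K := (nonneg_iff_isPositive K).2 hK.1
  have hL : IsSelfAdjoint (CFC.sqrt K) := (CFC.sqrt_nonneg K).isSelfAdjoint
  have hLL : CFC.sqrt K * CFC.sqrt K = K := CFC.sqrt_mul_sqrt_self K
  refine ⟨CFC.sqrt K, hL, hLL, ?_⟩
  have hs : Summable fun i => ⟪traceBasis (H := H) i, K (traceBasis i)⟫_ℂ := by
    by_contra h
    have h1 := hK.2
    rw [trace_eq, tsum_eq_zero_of_not_summable h] at h1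
    exact zero_ne_one h1
  refine (Complex.hasSum_re hs.hasSum).summable.congr fun i => ?_
  have h : ⟪traceBasis i, K (traceBasis i)⟫_ℂ =
      ⟪CFC.sqrt K (traceBasis i), CFC.sqrt K (traceBasis i)⟫_ℂ := by
    refine Eq.trans ?_ (hL.isSymmetric _ _).symm
    exact congr_arg (fun T : H →L[ℂ] H => ⟪traceBasis i, T (traceBasis i)⟫_ℂ) hLL.symm
  rw [h, inner_self_eq_norm_sq_to_K]
  norm_cast

theorem hasSum_normalState {L : H →L[ℂ] H} (hL : IsSelfAdjoint L) (hLL : L * L = K)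
    (hs : Summable fun i => ‖L (traceBasis (H := H) i)‖ ^ 2) (A : H →L[ℂ] H) :
    HasSum (fun i => ⟪L (traceBasis i), A (L (traceBasis i))⟫_ℂ) (normalState K A) := by
  obtain ⟨t, h1, h2⟩ := exists_hasSum_trace traceBasis traceBasis hL hs A
  rw [hLL] at h1
  rwa [normalState, trace_eq, h1.tsum_eq]

theorem normalState_add (hK : IsDensityOperator K) (A B : H →L[ℂ] H) :
    normalState K (A + B) = normalState K A + normalState K B := by
  obtain ⟨L, hL, hLL, hs⟩ := hK.exists_sqrt
  refine (hasSum_normalState hL hLL hs _).unique ?_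
  simpa [inner_add_right] using
    (hasSum_normalState hL hLL hs A).add (hasSum_normalState hL hLL hs B)

theorem normalState_smul (hK : IsDensityOperator K) (z : ℂ) (A : H →L[ℂ] H) :
    normalState K (z • A) = z * normalState K A := by
  obtain ⟨L, hL, hLL, hs⟩ := hK.exists_sqrt
  refine (hasSum_normalState hL hLL hs _).unique ?_
  simpa [inner_smul_right] using (hasSum_normalState hL hLL hs A).mul_left z

theorem hasSum_normalState_star_mul_self {L : H →L[ℂ] H} (hL : IsSelfAdjoint L) (hLL : L * L = K)
    (hs : Summable fun i => ‖L (traceBasis (H := H) i)‖ ^ 2) (C : H →L[ℂ] H) :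
    HasSum (fun i => ((‖C (L (traceBasis i))‖ ^ 2 : ℝ) : ℂ)) (normalState K (star C * C)) := by
  convert hasSum_normalState hL hLL hs (star C * C) using 2 with i
  rw [mul_apply_eq_comp, star_eq_adjoint, adjoint_inner_right, inner_self_eq_norm_sq_to_K]
  norm_cast

theorem normalState_star_mul_self_nonneg (hK : IsDensityOperator K) (C : H →L[ℂ] H) :
    0 ≤ normalState K (star C * C) := by
  obtain ⟨L, hL, hLL, hs⟩ := hK.exists_sqrt
  exact (hasSum_normalState_star_mul_self hL hLL hs C).nonneg fun i => by
    exact_mod_cast sq_nonneg ‖C (L (traceBasis i))‖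

/-- A vanishing sum of the nonnegative terms `‖C L bᵢ‖²` kills each of them, so `C L = 0` and `C K =
C L L = 0`. -/
theorem mul_eq_zero_of_normalState_eq_zero (hK : IsDensityOperator K) {C : H →L[ℂ] H}
    (hC : normalState K (star C * C) = 0) : C * K = 0 := by
  obtain ⟨L, hL, hLL, hs⟩ := hK.exists_sqrt
  have h := Complex.hasSum_ofReal.1 (hC ▸ hasSum_normalState_star_mul_self hL hLL hs C)
  have h0 := (hasSum_zero_iff_of_nonneg fun i => sq_nonneg _).1 h
  have hCL : C * L = 0 := by
    refine ContinuousLinearMap.ext_on (Submodule.dense_iff_topologicalClosure_eq_top.2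
      (traceBasis (H := H)).dense_span) ?_
    rintro _ ⟨i, rfl⟩
    simpa using congr_fun h0 i
  rw [← hLL, ← mul_assoc, hCL, zero_mul]

/-- When `U` commutes with `K`, conjugating by `U` amounts to computing the trace in the basis `U
bᵢ`, and the trace does not depend on the basis. -/
theorem normalState_conj_unitary (hK : IsDensityOperator K) {U : H →L[ℂ] H}
    (hU : U ∈ unitary (H →L[ℂ] H)) (hUK : U * K = K * U) (A : H →L[ℂ] H) :
    normalState K (star U * A * U) = normalState K A := by
  obtain ⟨L, hL, hLL, hs⟩ := hK.exists_sqrt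
  let f : HilbertBasis _ ℂ H :=
    .ofRepr ((Unitary.linearIsometryEquiv ⟨U, hU⟩).symm.trans (traceBasis (H := H)).repr)
  have hf : ∀ i, f i = U (traceBasis i) := fun _ => rfl
  have hsf : Summable fun i => ‖L (f i)‖ ^ 2 := by
    simpa [hL.star_eq] using summable_norm_adjoint_sq traceBasis f hs
  obtain ⟨t, h1, h2⟩ := exists_hasSum_trace f traceBasis hL hsf A
  rw [h2.unique (hasSum_normalState hL hLL hs A)] at h1
  rw [← h1.tsum_eq, normalState, trace_eq]
  refine tsum_congr fun i => ?_
  have hU' : K * star U = star U * K := by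
    simpa [hK.isSelfAdjoint.star_eq] using congr_arg star hUK
  rw [hf, hLL, ← mul_assoc, ← mul_assoc, hU', mul_assoc, mul_assoc, mul_apply_eq_comp,
    star_eq_adjoint, adjoint_inner_right, ← mul_assoc]
  rfl

theorem normalState_rankOne (hK : IsDensityOperator K) (x y : H) :
    normalState K (InnerProductSpace.rankOne ℂ x y) = ⟪y, K x⟫_ℂ := by
  obtain ⟨L, hL, hLL, hs⟩ := hK.exists_sqrt
  have hsymm : ∀ x y, ⟪L x, y⟫_ℂ = ⟪x, L y⟫_ℂ := fun x y => hL.isSymmetric x y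
  refine (hasSum_normalState hL hLL hs _).unique ?_
  rw [← hLL, mul_apply_eq_comp, ← hsymm]
  refine ((traceBasis (H := H)).hasSum_inner_mul_inner (L y) (L x)).congr_fun fun i => ?_
  rw [InnerProductSpace.rankOne_apply, inner_smul_right, hsymm, hsymm]

/-- The values of the state on rank-one operators are the matrix coefficients of `K`, so invariance
of the state gives `U K U* = K`. -/
theorem commute_of_normalState_conj (hK : IsDensityOperator K) {U : H →L[ℂ] H}
    (hU : U ∈ unitary (H →L[ℂ] H))
    (h : ∀ A, normalState K (star U * A * U) = normalState K A) : U * K = K * U := by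
  have h1 : U * K * star U = K := by
    refine ContinuousLinearMap.ext fun x => ext_inner_left ℂ fun y => ?_
    have h2 := h (InnerProductSpace.rankOne ℂ x y)
    have h3 : star U * InnerProductSpace.rankOne ℂ x y * U =
        InnerProductSpace.rankOne ℂ (star U x) (star U y) := by
      ext z
      simp [star_eq_adjoint, adjoint_inner_left]
    rw [h3, normalState_rankOne hK, normalState_rankOne hK] at h2
    rw [← h2, star_eq_adjoint, adjoint_inner_left]
    rfl
  rw [← mul_one (U * K), ← (Unitary.mem_iff.1 hU).1, ← mul_assoc, h1]

end Trace
end BeableAlgebra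

namespace BeableAlgebra

/-! ### States of commutative C⋆-algebras -/

section Riesz

open MeasureTheory WeakDual CompactlySupported

variable {D : Type*} [CommCStarAlgebra D]

/-- A continuous real function on the character space, as an element of the algebra. -/
noncomputable def ofRealFunction (f : C(characterSpace ℂ D, ℝ)) : D :=
  (gelfandStarTransform D).symm ((⟨Complex.ofReal, Complex.continuous_ofReal⟩ : C(ℝ, ℂ)).comp f)

theorem gelfandStarTransform_ofRealFunction (f : C(characterSpace ℂ D, ℝ)) :
    gelfandStarTransform D (ofRealFunction f) =
      (⟨Complex.ofReal, Complex.continuous_ofReal⟩ : C(ℝ, ℂ)).comp f :=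
  (gelfandStarTransform D).apply_symm_apply _

theorem apply_ofRealFunction (χ : characterSpace ℂ D) (f : C(characterSpace ℂ D, ℝ)) :
    χ (ofRealFunction f) = f χ :=
  DFunLike.congr_fun (gelfandStarTransform_ofRealFunction f) χ

theorem ext_characterSpace {a b : D} (h : ∀ χ : characterSpace ℂ D, χ a = χ b) : a = b :=
  (gelfandStarTransform D).injective (ContinuousMap.ext h)

theorem ofRealFunction_add (f g : C(characterSpace ℂ D, ℝ)) :
    ofRealFunction (f + g) = ofRealFunction f + ofRealFunction g :=
  ext_characterSpace fun χ => by simp [apply_ofRealFunction]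

theorem ofRealFunction_smul (c : ℝ) (f : C(characterSpace ℂ D, ℝ)) :
    ofRealFunction (c • f) = (c : ℂ) • ofRealFunction f :=
  ext_characterSpace fun χ => by
    rw [map_smul, apply_ofRealFunction, apply_ofRealFunction]
    simp

theorem ofRealFunction_nonneg_eq {f : C(characterSpace ℂ D, ℝ)} (hf : 0 ≤ f) :
    ∃ a : D, ofRealFunction f = star a * a := by
  refine ⟨ofRealFunction ⟨fun χ => √(f χ), by fun_prop⟩, ext_characterSpace fun χ => ?_⟩
  rw [map_mul, map_star, apply_ofRealFunction, apply_ofRealFunction]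
  simp only [ContinuousMap.coe_mk, RCLike.star_def, Complex.conj_ofReal]
  exact (congr_arg Complex.ofReal (Real.mul_self_sqrt (hf χ))).symm.trans (Complex.ofReal_mul _ _)

variable {φ : D →ₗ[ℂ] ℂ}

theorem im_apply_ofRealFunction (hpos : ∀ a, 0 ≤ φ (star a * a)) (f : C(characterSpace ℂ D, ℝ)) :
    (φ (ofRealFunction f)).im = 0 := by
  have h : ∀ g : C(characterSpace ℂ D, ℝ), 0 ≤ g → (φ (ofRealFunction g)).im = 0 := fun g hg => by
    obtain ⟨a, ha⟩ := ofRealFunction_nonneg_eq hg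
    rw [ha]
    exact ((Complex.nonneg_iff.1 (hpos a)).2).symm
  have hf : ofRealFunction f + ofRealFunction f⁻ = ofRealFunction f⁺ := by
    rw [← ofRealFunction_add]
    congr 1
    nth_rw 1 [← posPart_sub_negPart f]
    abel
  have := congr_arg (fun a => (φ a).im) hf
  simpa [h _ (negPart_nonneg f), h _ (posPart_nonneg f)] using this

/-- A state of a commutative unital C⋆-algebra is a mixture of characters. -/
theorem exists_measure_characterSpace [MeasurableSpace (characterSpace ℂ D)]
    [BorelSpace (characterSpace ℂ D)] (hpos : ∀ a, 0 ≤ φ (star a * a)) (h1 : φ 1 = 1) :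
    ∃ μ : Measure (characterSpace ℂ D), IsProbabilityMeasure μ ∧
      ∀ a, φ a = ∫ χ : characterSpace ℂ D, χ a ∂μ := by
  -- The character space is compact, so Riesz–Markov for compactly supported functions covers all
  -- real continuous functions. Complex ones are recovered below from real and imaginary parts.
  let Λ : C_c(characterSpace ℂ D, ℝ) →ₚ[ℝ] ℝ := PositiveLinearMap.mk₀
    { toFun := fun f => (φ (ofRealFunction f)).re
      map_add' := fun f g => by
        rw [← Complex.add_re, ← map_add, ← ofRealFunction_add]; rfl
      map_smul' := fun c f => by
        have h := ofRealFunction_smul c (f : C(characterSpace ℂ D, ℝ))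
        rw [show ofRealFunction ((c • f : C_c(characterSpace ℂ D, ℝ)) : C(characterSpace ℂ D, ℝ)) =
          _ from h, map_smul]
        simp }
    fun f hf => by
      obtain ⟨a, ha⟩ := ofRealFunction_nonneg_eq (f := (f : C(characterSpace ℂ D, ℝ))) hf
      simp only [LinearMap.coe_mk, AddHom.coe_mk, ha]
      exact (Complex.nonneg_iff.1 (hpos a)).1
  let μ := RealRMK.rieszMeasure Λ
  have hμ : ∀ f : C(characterSpace ℂ D, ℝ), ((∫ χ, f χ ∂μ : ℝ) : ℂ) = φ (ofRealFunction f) := by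
    intro f
    rw [show ∫ χ, f χ ∂μ = (φ (ofRealFunction f)).re from
      RealRMK.integral_rieszMeasure Λ (CompactlySupportedContinuousMap.continuousMapEquiv f)]
    exact Complex.ext rfl (im_apply_ofRealFunction hpos f).symm
  have hprob : IsProbabilityMeasure μ := by
    have h := hμ 1
    rw [show ofRealFunction (1 : C(characterSpace ℂ D, ℝ)) = 1 from
      ext_characterSpace fun χ => by simp [apply_ofRealFunction], h1] at h
    simp only [ContinuousMap.one_apply, integral_const, smul_eq_mul, mul_one] at h
    refine ⟨(ENNReal.toReal_eq_one_iff _).1 ?_⟩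
    exact_mod_cast h
  refine ⟨μ, hprob, fun a => ?_⟩
  let f : C(characterSpace ℂ D, ℂ) := gelfandStarTransform D a
  let fr : C(characterSpace ℂ D, ℝ) := ⟨fun χ => (f χ).re, by fun_prop⟩
  let fi : C(characterSpace ℂ D, ℝ) := ⟨fun χ => (f χ).im, by fun_prop⟩
  have ha : a = ofRealFunction fr + Complex.I • ofRealFunction fi :=
    ext_characterSpace fun χ => by
      rw [map_add, map_smul, apply_ofRealFunction, apply_ofRealFunction, smul_eq_mul, mul_comm]
      exact (Complex.re_add_im (χ a)).symm
  have hint : Integrable f μ := f.continuous.integrable_of_hasCompactSupport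
    (HasCompactSupport.of_compactSpace _)
  have h := integral_re_add_im hint
  change _ = ∫ χ, f χ ∂μ
  rw [← h]
  nth_rw 1 [ha]
  rw [map_add, map_smul, ← hμ, ← hμ, smul_eq_mul, mul_comm]
  rfl

end Riesz
end BeableAlgebra

namespace BeableAlgebra

/-! ### Abelian ⋆-subalgebras and commutants in C⋆-algebras -/

section CStar

variable {𝔄 : Type*} [CStarAlgebra 𝔄]

theorem star_mem_centralizer_of_star_mem {F : Set 𝔄} (hF : ∀ A ∈ F, star A ∈ F) {X : 𝔄}
    (hX : X ∈ F.centralizer) : star X ∈ F.centralizer := fun A hA => by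
  simpa using (congr_arg star (hX (star A) (hF A hA))).symm

/-- If `a` commutes with `[a, X]` for all `X` in a commutant, then it commutes with all `X`. -/
theorem mem_centralizer_of_commute_commutator {F : Set 𝔄} (hF : ∀ A ∈ F, star A ∈ F) {a : 𝔄}
    (ha : IsSelfAdjoint a)
    (h : ∀ X ∈ F.centralizer, IsSelfAdjoint X → a * (a * X - X * a) = (a * X - X * a) * a) :
    a ∈ F.centralizer.centralizer := by
  have hsa : ∀ X ∈ F.centralizer, IsSelfAdjoint X → X * a = a * X := fun X hX hXs => by
    have h1 := h X hX hXs
    -- Apply the hypothesis to `X²` as well: for the derivation `δ = [a, ·]`, `δ²(X) = 0` and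
    -- `δ²(X²) = 0` give `2 δ(X)² = 0` by Leibniz. As a commutator of self-adjoint elements, `δ(X)`
    -- is skew-adjoint, so its square vanishes only if it does.
    have h2 := h (X * X) (Set.mul_mem_centralizer hX hX) (by
      rw [isSelfAdjoint_iff, star_mul, hXs.star_eq])
    set d := a * X - X * a with hd
    have hXX : a * (X * X) - X * X * a = d * X + X * d := by rw [hd]; noncomm_ring
    have hdd : d * d + d * d = 0 := by
      rw [hXX, ← sub_eq_zero] at h2
      have : a * (d * X + X * d) - (d * X + X * d) * a =
          (a * d - d * a) * X + d * d + d * d + X * (a * d - d * a) := by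
        rw [hd]; noncomm_ring
      rw [this, h1] at h2
      simpa using h2
    have hdd' : d * d = 0 := by
      rw [← two_smul ℂ] at hdd
      exact (smul_eq_zero.1 hdd).resolve_left two_ne_zero
    have hds : star d = -d := by
      rw [hd, star_sub, star_mul, star_mul, ha.star_eq, hXs.star_eq]; abel
    have hd0 : d = 0 := by
      rw [← CStarRing.star_mul_self_eq_zero_iff, hds, neg_mul, hdd', neg_zero]
    exact (sub_eq_zero.1 hd0).symm
  intro X hX
  have hXs := star_mem_centralizer_of_star_mem hF hX
  have h1 : (X + star X) * a = a * (X + star X) :=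
    hsa _ (Set.add_mem_centralizer hX hXs) (by simp [isSelfAdjoint_iff, add_comm])
  have h2 : (Complex.I • (X - star X)) * a = a * (Complex.I • (X - star X)) := by
    refine hsa _ ?_ ?_
    · intro A hA
      rw [mul_smul_comm, smul_mul_assoc, mul_sub, sub_mul, hX A hA, hXs A hA]
    · rw [isSelfAdjoint_iff, star_smul, star_sub, star_star, RCLike.star_def, Complex.conj_I,
        neg_smul, ← smul_neg, neg_sub]
  rw [smul_mul_assoc, mul_smul_comm] at h2
  have h3 : (X - star X) * a = a * (X - star X) := smul_right_injective 𝔄 Complex.I_ne_zero h2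
  rw [add_mul, mul_add] at h1
  rw [sub_mul, mul_sub] at h3
  have h4 : (2 : ℂ) • (X * a) = (2 : ℂ) • (a * X) := by
    rw [two_smul, two_smul]
    calc X * a + X * a = X * a + star X * a + (X * a - star X * a) := by abel
      _ = a * X + a * X := by rw [h1, h3]; abel
  exact smul_right_injective 𝔄 two_ne_zero h4

/-- If `a` commutes with all its conjugates by the unitaries of a commutant, then it commutes with
the commutant. -/
theorem mem_centralizer_of_commute_conj {F : Set 𝔄} (hF : ∀ A ∈ F, star A ∈ F) {a : 𝔄}
    (ha : IsSelfAdjoint a)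
    (h : ∀ U ∈ unitary 𝔄, U ∈ F.centralizer → a * (U * a * star U) = (U * a * star U) * a) :
    a ∈ F.centralizer.centralizer := by
  refine mem_centralizer_of_commute_commutator hF ha fun X hX hXs => ?_
  let : NormedAlgebra ℚ 𝔄 := NormedAlgebra.restrictScalars ℚ ℂ 𝔄
  set x : 𝔄 := Complex.I • X with hx
  have hxs : star x = -x := by simp [hx, hXs.star_eq]
  -- Along the unitary group `exp(itX)` the commutation relation holds for every `t`; its derivative
  -- at `0` says that `a` commutes with `i[X, a]`.
  have hg : ∀ t : ℝ, a * (NormedSpace.exp (t • x) * a * NormedSpace.exp (t • -x)) -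
      NormedSpace.exp (t • x) * a * NormedSpace.exp (t • -x) * a = 0 := fun t => by
    have hsk : t • x ∈ skewAdjoint 𝔄 := by
      rw [skewAdjoint.mem_iff, star_smul, hxs, smul_neg]; simp
    have hst : NormedSpace.exp (t • -x) = star (NormedSpace.exp (t • x)) := by
      rw [NormedSpace.star_exp, star_smul, hxs]; simp
    rw [hst, sub_eq_zero]
    refine h _ (NormedSpace.exp_mem_unitary_of_mem_skewAdjoint hsk) fun A hA => ?_
    refine (Commute.exp_right ?_).eq
    refine Commute.smul_right ?_ t
    exact Commute.smul_right (hX A hA) _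
  have hd1 := hasDerivAt_exp_smul_const (𝕂 := ℝ) x 0
  have hd2 := hasDerivAt_exp_smul_const (𝕂 := ℝ) (-x) 0
  have hd := (hd1.mul_const a).mul hd2
  have hD := (hd.const_mul a).sub (hd.mul_const a)
  have h0 := hD.unique ((hasDerivAt_const (0 : ℝ) (0 : 𝔄)).congr_of_eventuallyEq
    (Filter.Eventually.of_forall hg))
  simp only [zero_smul, NormedSpace.exp_zero, one_mul, mul_one, hx] at h0
  have h1 : Complex.I • ((a * X - X * a) * a - a * (a * X - X * a)) = 0 := by
    rw [← h0]
    simp only [mul_add, add_mul, mul_neg, neg_mul, smul_mul_assoc, mul_smul_comm, sub_mul, mul_sub,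
      smul_sub, mul_assoc]
    abel
  exact (sub_eq_zero.1 ((smul_eq_zero.1 h1).resolve_left Complex.I_ne_zero)).symm

variable {C N M : NonUnitalStarSubalgebra ℂ 𝔄}

theorem adjoin_le_and_commute {s : Set 𝔄} (hs : s ⊆ C) (hstar : ∀ x ∈ s, star x ∈ s)
    (hcomm : ∀ x ∈ s, ∀ y ∈ s, x * y = y * x) :
    ((NonUnitalStarAlgebra.adjoin ℂ s : NonUnitalStarSubalgebra ℂ 𝔄) : Set 𝔄) ⊆ C ∧
      ∀ A ∈ NonUnitalStarAlgebra.adjoin ℂ s, ∀ B ∈ NonUnitalStarAlgebra.adjoin ℂ s,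
        A * B = B * A := by
  refine ⟨NonUnitalStarAlgebra.adjoin_le hs, fun A hA B hB => ?_⟩
  have := NonUnitalStarAlgebra.isMulCommutative_adjoin ℂ hcomm
    fun x hx y hy => hcomm x hx _ (hstar y hy)
  exact congr_arg Subtype.val (this.is_comm.comm ⟨A, hA⟩ ⟨B, hB⟩)

/-- An element of `C` that commutes with a maximal abelian ⋆-subalgebra of `C` belongs to it. -/
theorem mem_of_maximal_abelian
    (hM : Maximal (fun N : NonUnitalStarSubalgebra ℂ 𝔄 =>
      (N : Set 𝔄) ⊆ C ∧ ∀ A ∈ N, ∀ B ∈ N, A * B = B * A) M)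
    {X : 𝔄} (hX : X ∈ C) (hXM : ∀ A ∈ M, A * X = X * A) : X ∈ M := by
  -- `X` is not assumed normal, so it cannot be adjoined to `M` directly. Self-adjoint elements can,
  -- and the real and imaginary parts of `X` also commute with `M`.
  have hsa : ∀ Y ∈ C, (∀ A ∈ M, A * Y = Y * A) → IsSelfAdjoint Y → Y ∈ M := fun Y hY hYM hYs => by
    have h := adjoin_le_and_commute (C := C) (s := insert Y M) (Set.insert_subset hY hM.prop.1)
      (by
        rintro x (rfl | hx)
        · rw [hYs.star_eq]; exact Set.mem_insert _ _
        · exact Set.mem_insert_of_mem _ (star_mem hx))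
      (by
        rintro x (rfl | hx) y (rfl | hy)
        · rfl
        · exact (hYM y hy).symm
        · exact hYM x hx
        · exact hM.prop.2 x hx y hy)
    exact hM.le_of_ge h ((Set.subset_insert _ _).trans (NonUnitalStarAlgebra.subset_adjoin ℂ _))
      (NonUnitalStarAlgebra.subset_adjoin ℂ _ (Set.mem_insert _ _))
  have hsX : ∀ A ∈ M, A * star X = star X * A := fun A hA => by
    simpa using (congr_arg star (hXM (star A) (star_mem hA))).symm
  have h1 := hsa (realPart X : 𝔄) (by
      rw [realPart_apply_coe, ← Complex.coe_smul]
      exact C.smul_mem' _ (add_mem hX (star_mem hX)))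
    (fun A hA => by
      rw [realPart_apply_coe, mul_smul_comm, smul_mul_assoc, mul_add, add_mul, hXM A hA, hsX A hA])
    (realPart X).2
  have h2 := hsa (imaginaryPart X : 𝔄) (by
      rw [imaginaryPart_apply_coe, ← Complex.coe_smul]
      exact C.smul_mem' _ (C.smul_mem' _ (sub_mem hX (star_mem hX))))
    (fun A hA => by
      rw [imaginaryPart_apply_coe, mul_smul_comm, mul_smul_comm, smul_mul_assoc, smul_mul_assoc,
        mul_sub, sub_mul, hXM A hA, hsX A hA])
    (imaginaryPart X).2
  rw [← realPart_add_I_smul_imaginaryPart X]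
  exact add_mem h1 (M.smul_mem' _ h2)

/-- Every abelian ⋆-subalgebra of `C` is contained in a maximal one. -/
theorem exists_maximal_abelian (hN : (N : Set 𝔄) ⊆ C ∧ ∀ A ∈ N, ∀ B ∈ N, A * B = B * A) :
    ∃ M, N ≤ M ∧ Maximal (fun N : NonUnitalStarSubalgebra ℂ 𝔄 =>
      (N : Set 𝔄) ⊆ C ∧ ∀ A ∈ N, ∀ B ∈ N, A * B = B * A) M := by
  refine zorn_le_nonempty₀ {N : NonUnitalStarSubalgebra ℂ 𝔄 |
      (N : Set 𝔄) ⊆ C ∧ ∀ A ∈ N, ∀ B ∈ N, A * B = B * A} (fun c hc hch _ _ => ?_) N hN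
  refine ⟨NonUnitalStarAlgebra.adjoin ℂ (⋃ M ∈ c, (M : Set 𝔄)), ?_, fun M hM => ?_⟩
  · refine adjoin_le_and_commute (Set.iUnion₂_subset fun M hM => (hc hM).1) ?_ ?_
    · simp only [Set.mem_iUnion₂]
      rintro x ⟨M, hM, hx⟩
      exact ⟨M, hM, star_mem hx⟩
    · simp only [Set.mem_iUnion₂]
      rintro x ⟨M, hM, hx⟩ y ⟨N, hN, hy⟩
      rcases hch.total hM hN with h | h
      · exact (hc hN).2 x (h hx) y hy
      · exact (hc hM).2 x hx y (h hy)
  · exact (Set.subset_iUnion₂ (s := fun (M : NonUnitalStarSubalgebra ℂ 𝔄) (_ : M ∈ c) =>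
      (M : Set 𝔄)) M hM).trans (NonUnitalStarAlgebra.subset_adjoin ℂ _)

/-- The reduced algebra `V e` for a projection `e` that commutes with `V`. -/
def reducedAlgebra (V : StarSubalgebra ℂ 𝔄) (e : 𝔄) (hes : IsSelfAdjoint e)
    (he : ∀ X ∈ V, X * e = e * X) : NonUnitalStarSubalgebra ℂ 𝔄 where
  carrier := {X | X ∈ V ∧ X * e = X}
  add_mem' := fun ⟨hX, hXe⟩ ⟨hY, hYe⟩ => ⟨add_mem hX hY, by rw [add_mul, hXe, hYe]⟩
  zero_mem' := ⟨zero_mem V, zero_mul e⟩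
  mul_mem' := fun {X Y} ⟨hX, hXe⟩ ⟨hY, hYe⟩ => ⟨mul_mem hX hY, by rw [mul_assoc, hYe]⟩
  smul_mem' := fun c X ⟨hX, hXe⟩ => ⟨V.smul_mem hX c, by rw [smul_mul_assoc, hXe]⟩
  star_mem' := fun {X} ⟨hX, hXe⟩ => ⟨star_mem hX, by
    have h := congr_arg star ((he X hX).symm.trans hXe)
    rwa [star_mul, hes.star_eq] at h⟩

theorem coe_reducedAlgebra {V : StarSubalgebra ℂ 𝔄} {e : 𝔄} {hes : IsSelfAdjoint e}
    {he : ∀ X ∈ V, X * e = e * X} (heV : e ∈ V) (hee : e * e = e) :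
    (reducedAlgebra V e hes he : Set 𝔄) = (fun A => A * e) '' (V : Set 𝔄) := by
  ext X
  constructor
  · rintro ⟨hX, hXe⟩
    exact ⟨X, hX, hXe⟩
  · rintro ⟨A, hA, rfl⟩
    exact ⟨mul_mem hA heV, by simp only [mul_assoc, hee]⟩

end CStar
end BeableAlgebra

namespace BeableAlgebra

variable {H : Type*} [NormedAddCommGroup H] [InnerProductSpace ℂ H] [CompleteSpace H]

/-! ### Commutants on Hilbert space and the subspace `[R'' range K]` -/

section Subspace

open ContinuousLinearMap

/-- The double commutant of a self-adjoint set of operators. -/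
noncomputable def bicommutant (F : Set (H →L[ℂ] H)) :
    VonNeumannAlgebra H where
  toStarSubalgebra := StarSubalgebra.centralizer ℂ F.centralizer
  centralizer_centralizer' := by
    change Set.centralizer (Set.centralizer
      (StarSubalgebra.centralizer ℂ F.centralizer : Set (H →L[ℂ] H))) =
      (StarSubalgebra.centralizer ℂ F.centralizer : Set (H →L[ℂ] H))
    rw [StarSubalgebra.coe_centralizer, Set.centralizer_centralizer_centralizer]

/-- `StarSubalgebra.centralizer` takes the commutant of a set together with its adjoints; the
adjoints add nothing, since the commutant of a self-adjoint set is self-adjoint. -/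
theorem coe_bicommutant {F : Set (H →L[ℂ] H)} (hF : ∀ A ∈ F, star A ∈ F) :
    (bicommutant F : Set (H →L[ℂ] H)) = F.centralizer.centralizer := by
  change (StarSubalgebra.centralizer ℂ F.centralizer : Set (H →L[ℂ] H)) = _
  rw [StarSubalgebra.coe_centralizer]
  congr 1
  refine Set.union_eq_self_of_subset_right fun X hX => ?_
  simpa using star_mem_centralizer_of_star_mem hF (Set.mem_star.1 hX)

/-- The generated von Neumann algebra is the double commutant. -/
theorem vN_eq {F : Set (H →L[ℂ] H)} (hF : ∀ A ∈ F, star A ∈ F) :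
    vN F = F.centralizer.centralizer := by
  refine Set.Subset.antisymm ?_ (Set.subset_iInter₂ fun V hV => ?_)
  · refine (Set.iInter₂_subset (bicommutant F) ?_).trans (coe_bicommutant hF).subset
    change F ⊆ (bicommutant F : Set (H →L[ℂ] H))
    rw [coe_bicommutant hF]
    exact Set.subset_centralizer_centralizer
  · rw [← V.centralizer_centralizer]
    exact Set.centralizer_subset (Set.centralizer_subset hV)

theorem commute_starProjection {Y : Submodule ℂ H} [Y.HasOrthogonalProjection] {A : H →L[ℂ] H}
    (h : ∀ y ∈ Y, A y ∈ Y) (h' : ∀ y ∈ Y, star A y ∈ Y) :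
    A * Y.starProjection = Y.starProjection * A := by
  have key : ∀ B : H →L[ℂ] H, (∀ y ∈ Y, B y ∈ Y) →
      Y.starProjection * (B * Y.starProjection) = B * Y.starProjection := fun B hB =>
    ContinuousLinearMap.ext fun x => Submodule.starProjection_eq_self_iff.2
      (hB _ (Submodule.starProjection_apply_mem Y x))
  have h1 := congr_arg star (key (star A) h')
  simp only [star_mul, star_star, (isSelfAdjoint_starProjection Y).star_eq] at h1
  rw [← key A h, ← mul_assoc, h1]

variable {R : Set (H →L[ℂ] H)} {K : H →L[ℂ] H}

/-- Because `R` is self-adjoint, an invariant closed subspace is reducing, so its projection lies in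
`R'` and commutes with `R''`. -/
theorem apply_mem_of_mem_bicommutant (hR : ∀ A ∈ R, IsSelfAdjoint A) {Y : Submodule ℂ H}
    (hY : IsClosed (Y : Set H)) (hRY : ∀ A ∈ R, ∀ y ∈ Y, A y ∈ Y) {A : H →L[ℂ] H}
    (hA : A ∈ R.centralizer.centralizer) {y : H} (hy : y ∈ Y) : A y ∈ Y := by
  have : CompleteSpace Y := hY.completeSpace_coe
  have hP : Y.starProjection ∈ R.centralizer := fun B hB =>
    commute_starProjection (hRY B hB) (by rw [(hR B hB).star_eq]; exact hRY B hB)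
  have h := DFunLike.congr_fun (hA _ hP) y
  rw [mul_apply_eq_comp, mul_apply_eq_comp, Submodule.starProjection_eq_self_iff.2 hy] at h
  exact Submodule.starProjection_eq_self_iff.1 h

theorem privSubspace_le (hR : ∀ A ∈ R, IsSelfAdjoint A) {Y : Submodule ℂ H}
    (hY : IsClosed (Y : Set H)) (hKY : Set.range K ⊆ Y) (hRY : ∀ A ∈ R, ∀ y ∈ Y, A y ∈ Y) :
    privSubspace R K ≤ Y := by
  refine Submodule.topologicalClosure_minimal _ (Submodule.span_le.2 ?_) hY
  rintro _ ⟨A, hA, x, hx, rfl⟩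
  exact apply_mem_of_mem_bicommutant hR hY hRY hA (closure_minimal hKY hY hx)

omit [CompleteSpace H] in
theorem apply_mem_privSubspace {A : H →L[ℂ] H} (hA : A ∈ R.centralizer.centralizer) {x : H}
    (hx : x ∈ closure (Set.range K)) : A x ∈ privSubspace R K :=
  Submodule.le_topologicalClosure _ (Submodule.subset_span ⟨A, hA, x, hx, rfl⟩)

omit [CompleteSpace H] in
/-- An operator that maps the generating vectors of `[R'' range K]` into this subspace leaves it
invariant. -/
theorem apply_mem_privSubspace_of_generators {T : H →L[ℂ] H}
    (hT : ∀ A ∈ R.centralizer.centralizer, ∀ x ∈ closure (Set.range K),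
      T (A x) ∈ privSubspace R K) {y : H} (hy : y ∈ privSubspace R K) :
    T y ∈ privSubspace R K := by
  have hle : privSubspace R K ≤ (privSubspace R K).comap (T : H →ₗ[ℂ] H) := by
    refine Submodule.topologicalClosure_minimal _ (Submodule.span_le.2 ?_) ?_
    · rintro _ ⟨A, hA, x, hx, rfl⟩
      exact hT A hA x hx
    · exact (Submodule.isClosed_topologicalClosure _).preimage T.continuous
  exact hle hy

omit [CompleteSpace H] in
theorem range_subset_privSubspace : Set.range K ⊆ privSubspace R K := fun x hx => by
  simpa using apply_mem_privSubspace (R := R) (A := 1) (Set.one_mem_centralizer)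
    (subset_closure hx)

omit [CompleteSpace H] in
theorem apply_mem_privSubspace_of_mem {A : H →L[ℂ] H} (hA : A ∈ R) {y : H}
    (hy : y ∈ privSubspace R K) : A y ∈ privSubspace R K :=
  apply_mem_privSubspace_of_generators (fun B hB x hx => by
    rw [← mul_apply_eq_comp]
    exact apply_mem_privSubspace
      (Set.mul_mem_centralizer (Set.subset_centralizer_centralizer hA) hB) hx) hy

/-- `[R'' range K]` is the smallest closed `R`-invariant subspace that contains the range of
`K`. -/
theorem isLeast_privSubspace (hR : ∀ A ∈ R, IsSelfAdjoint A) :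
    IsLeast {Y : Submodule ℂ H | IsClosed (Y : Set H) ∧ Set.range K ⊆ Y ∧
      ∀ A ∈ R, ∀ y ∈ Y, A y ∈ Y} (privSubspace R K) :=
  ⟨⟨Submodule.isClosed_topologicalClosure _, range_subset_privSubspace,
    fun _ hA _ hy => apply_mem_privSubspace_of_mem hA hy⟩,
    fun _ hY => privSubspace_le hR hY.1 hY.2.1 hY.2.2⟩

theorem isSelfAdjoint_privProj : IsSelfAdjoint (privProj R K) := isSelfAdjoint_starProjection _

theorem privProj_mul_self : privProj R K * privProj R K = privProj R K :=
  (Submodule.isIdempotentElem_starProjection _).eq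

theorem privProj_mul : privProj R K * K = K :=
  ContinuousLinearMap.ext fun x => Submodule.starProjection_eq_self_iff.2
    (range_subset_privSubspace ⟨x, rfl⟩)

theorem mul_privProj (hK : IsSelfAdjoint K) : K * privProj R K = K := by
  simpa [isSelfAdjoint_privProj.star_eq, hK.star_eq] using
    congr_arg star (privProj_mul (R := R) (K := K))

theorem star_mem_insert (hR : ∀ A ∈ R, IsSelfAdjoint A) (hK : IsSelfAdjoint K) :
    ∀ A ∈ insert K R, star A ∈ insert K R := by
  rintro A (rfl | hA)
  · rw [hK.star_eq]; exact Set.mem_insert _ _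
  · rw [(hR A hA).star_eq]; exact Set.mem_insert_of_mem _ hA

theorem privProj_mem_centralizer (hR : ∀ A ∈ R, IsSelfAdjoint A) (hK : IsSelfAdjoint K) :
    privProj R K ∈ (insert K R).centralizer := by
  rintro A (rfl | hA)
  · rw [mul_privProj hK, privProj_mul]
  · refine commute_starProjection (fun y hy => apply_mem_privSubspace_of_mem hA hy) ?_
    rw [(hR A hA).star_eq]
    exact fun y hy => apply_mem_privSubspace_of_mem hA hy

/-- Elements of `(R ∪ {K})'` commute with `R''` and preserve the range of `K`, hence preserve `S`.
The same holds for their adjoints, so they commute with the projection. -/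
theorem privProj_mem_bicommutant (hR : ∀ A ∈ R, IsSelfAdjoint A) (hK : IsSelfAdjoint K) :
    privProj R K ∈ (insert K R).centralizer.centralizer := by
  have key : ∀ T ∈ (insert K R).centralizer, ∀ y ∈ privSubspace R K, T y ∈ privSubspace R K := by
    intro T hT y hy
    refine apply_mem_privSubspace_of_generators (fun A hA x hx => ?_) hy
    have hTR : T ∈ R.centralizer := Set.centralizer_subset (Set.subset_insert _ _) hT
    rw [← mul_apply_eq_comp, hA T hTR, mul_apply_eq_comp]
    refine apply_mem_privSubspace hA (map_mem_closure T.continuous hx ?_)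
    rintro _ ⟨z, rfl⟩
    exact ⟨T z, DFunLike.congr_fun (hT K (Set.mem_insert _ _)) z⟩
  exact fun T hT => commute_starProjection (key T hT)
    (key _ (star_mem_centralizer_of_star_mem (star_mem_insert hR hK) hT))

/-- An operator that annihilates `Y x` for `x` in the range of `K` and `Y` in an algebra containing
`R` annihilates `[R'' range K]`. -/
theorem mul_privProj_eq_zero (hR : ∀ A ∈ R, IsSelfAdjoint A) {B : StarSubalgebra ℂ (H →L[ℂ] H)}
    (hRB : R ⊆ B) {C : H →L[ℂ] H} (hC : ∀ Y ∈ B, C * Y * K = 0) : C * privProj R K = 0 := by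
  -- The common kernel of all `C Y` is `R`-invariant because `Y A` stays in `B` for `A ∈ R`; taking
  -- `Y = 1` at the end recovers `C`.
  let Z : Submodule ℂ H := ⨅ Y ∈ B, LinearMap.ker ((C * Y : H →L[ℂ] H) : H →ₗ[ℂ] H)
  have hZ : ∀ z, z ∈ Z ↔ ∀ Y ∈ B, (C * Y) z = 0 := fun z => by simp [Z]
  have hle : privSubspace R K ≤ Z := by
    refine privSubspace_le hR ?_ ?_ ?_
    · have : (Z : Set H) = ⋂ Y ∈ B, {z | (C * Y) z = 0} := by
        ext z; simp only [SetLike.mem_coe, hZ, Set.mem_iInter, Set.mem_ofPred_eq]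
      rw [this]
      exact isClosed_biInter fun Y _ => isClosed_eq (C * Y).continuous continuous_const
    · rintro _ ⟨x, rfl⟩
      exact (hZ _).2 fun Y hY => DFunLike.congr_fun (hC Y hY) x
    · exact fun A hA y hy => (hZ _).2 fun Y hY => (hZ y).1 hy (Y * A) (mul_mem hY (hRB hA))
  have h := fun x => (hZ _).1 (hle (Submodule.starProjection_apply_mem _ x)) 1 (one_mem B)
  simp only [mul_one] at h
  exact ContinuousLinearMap.ext h

end Subspace
end BeableAlgebra

namespace BeableAlgebra

variable {H : Type*} [NormedAddCommGroup H] [InnerProductSpace ℂ H] [CompleteSpace H]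

/-! ### Necessary conditions for `R`-beable algebras -/

section Necessary

variable {R : Set (H →L[ℂ] H)} {K : H →L[ℂ] H} {B : StarSubalgebra ℂ (H →L[ℂ] H)}

/-- Multiplicative states vanish on `|[A, X] Y|²`, hence so does their mixture. The extra factor `Y`
is what makes the annihilated vectors an `R`-invariant subspace. -/
theorem commutator_mul_mul_eq_zero (hK : IsDensityOperator K) (hB : IsBeable (normalState K) B)
    {A X Y : H →L[ℂ] H} (hA : A ∈ B) (hX : X ∈ B) (hY : Y ∈ B) :
    (A * X - X * A) * Y * K = 0 := by
  obtain ⟨μ, -, hμ⟩ := hB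
  let A' : B := ⟨A, hA⟩
  let X' : B := ⟨X, hX⟩
  let Y' : B := ⟨Y, hY⟩
  refine mul_eq_zero_of_normalState_eq_zero hK ?_
  refine (hμ (star ((A' * X' - X' * A') * Y') * ((A' * X' - X' * A') * Y'))).trans ?_
  refine (MeasureTheory.integral_congr_ae (.of_forall fun ω => ?_)).trans
    (MeasureTheory.integral_zero _ _)
  obtain ⟨ω, -, -, hω⟩ := ω
  change ω _ = 0
  rw [hω, hω (A' * X' - X' * A'), map_sub, hω, hω, mul_comm (ω X'), sub_self, zero_mul, mul_zero]

variable (hR : ∀ A ∈ R, IsSelfAdjoint A) (hK : IsDensityOperator K)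
  (hB : IsRBeable R (normalState K) B)

include hR hK hB

theorem commutator_mul_privProj {A X : H →L[ℂ] H} (hA : A ∈ B) (hX : X ∈ B) :
    (A * X - X * A) * privProj R K = 0 :=
  mul_privProj_eq_zero hR hB.priv fun _ hY => commutator_mul_mul_eq_zero hK hB.beable hA hX hY

omit hR in
theorem conj_mem {U A : H →L[ℂ] H} (hU : U ∈ unitary (H →L[ℂ] H))
    (hUW : U ∈ (insert K R).centralizer) (hA : A ∈ B) : U * A * star U ∈ B := by
  have h := hB.definable U hU (Set.centralizer_subset (Set.subset_insert _ _) hUW)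
    (normalState_conj_unitary hK hU (hUW K (Set.mem_insert _ _)).symm)
  have h2 : U * A * star U ∈ (fun A => U * A * star U) '' (B : Set (H →L[ℂ] H)) := ⟨A, hA, rfl⟩
  rwa [h] at h2

theorem privProj_mul_mul_one_sub_eq_zero {A : H →L[ℂ] H} (hA : A ∈ B) :
    privProj R K * A * (1 - privProj R K) = 0 := by
  have hpp := privProj_mul_self (R := R) (K := K)
  have hps := isSelfAdjoint_privProj (R := R) (K := K)
  have hpW := privProj_mem_centralizer hR hK.isSelfAdjoint
  set p := privProj R K with hp
  set q := 1 - p with hq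
  have hqq : q * q = q := by rw [hq]; simp [mul_sub, sub_mul, hpp]
  have hpq : p * q = 0 := by rw [hq]; simp [mul_sub, hpp]
  have hqp : q * p = 0 := by rw [hq]; simp [sub_mul, hpp]
  have hpq1 : p + q = 1 := by rw [hq]; abel
  have hqs : star q = q := by rw [hq, star_sub, hps.star_eq, star_one]
  have hqW : q ∈ (insert K R).centralizer := fun T hT => by
    rw [hq, mul_sub, sub_mul, hpW T hT, mul_one, one_mul]
  -- the unitaries `p + z q` belong to the commutant
  have hU : ∀ z : ℂ, z * star z = 1 → (p + z • q) * A * (p + star z • q) ∈ B := fun z hz => by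
    have hst : star (p + z • q) = p + star z • q := by
      rw [star_add, star_smul, hps.star_eq, hqs]
    rw [← hst]
    refine conj_mem hK hB ?_ ?_ hA
    · rw [Unitary.mem_iff, hst]
      simp only [mul_add, add_mul, smul_mul_assoc, mul_smul_comm, hpp, hqq,
        hpq, hqp, smul_smul, smul_zero, add_zero, zero_add]
      rw [mul_comm (star z), hz, one_smul, hpq1]
      exact ⟨rfl, rfl⟩
    · exact Set.add_mem_centralizer hpW fun T hT => by
        rw [mul_smul_comm, smul_mul_assoc, hqW T hT]
  have h1 := hU (-1) (by simp)
  have h2 := hU Complex.I (by simp)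
  have h3 := hU (-Complex.I) (by simp)
  have hA4 : (p + q) * A * (p + q) ∈ B := by rwa [hpq1, one_mul, mul_one]
  -- Conjugation by `p + z q` multiplies `p A q` by the conjugate of `z`. Weighting by `z` and
  -- averaging over the fourth roots of unity isolates this corner.
  have hX : p * A * q ∈ B := by
    have h : p * A * q = (4⁻¹ : ℂ) • (((p + q) * A * (p + q) -
        (p + (-1 : ℂ) • q) * A * (p + star (-1 : ℂ) • q)) - Complex.I •
        ((p + (-Complex.I) • q) * A * (p + star (-Complex.I) • q) -
          (p + Complex.I • q) * A * (p + star Complex.I • q))) := by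
      simp only [mul_add, add_mul, smul_mul_assoc, mul_smul_comm, star_neg, star_one,
        RCLike.star_def, Complex.conj_I, neg_neg, smul_add, smul_sub, smul_smul, neg_smul, mul_neg,
        neg_mul, Complex.I_mul_I, one_smul, smul_neg]
      module
    rw [h]
    exact B.smul_mem (sub_mem (sub_mem hA4 h1) (B.smul_mem (sub_mem h3 h2) _)) _
  have h := commutator_mul_privProj hR hK hB hX (star_mem hX)
  rw [← hp] at h
  -- With `X = p A q` one has `X p = 0`, so `[X, X*] p = X X*`; commutativity on `S` then forces `X
  -- = 0`.
  have h0 : (p * A * q * star (p * A * q) - star (p * A * q) * (p * A * q)) * p =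
      p * A * q * star (p * A * q) := by
    simp only [star_mul, hps.star_eq, hqs, sub_mul, mul_assoc, hqp, mul_zero, sub_zero, hpp]
  exact (CStarRing.mul_star_self_eq_zero_iff _).1 (h0 ▸ h)

/-- The elements of an `R`-beable algebra are reduced by `[R'' range K]`. -/
theorem mul_privProj_comm {A : H →L[ℂ] H} (hA : A ∈ B) :
    A * privProj R K = privProj R K * A := by
  have h1 := privProj_mul_mul_one_sub_eq_zero hR hK hB hA
  have h2 := congr_arg star (privProj_mul_mul_one_sub_eq_zero hR hK hB (star_mem hA))
  simp only [star_mul, star_sub, star_one, star_star, isSelfAdjoint_privProj.star_eq, star_zero,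
    ← mul_assoc] at h2
  rw [mul_sub, mul_one, sub_eq_zero] at h1
  rw [sub_mul, one_mul, sub_mul, sub_eq_zero] at h2
  rw [h1, h2]

/-- The restriction to `[R'' range K]` of an `R`-beable algebra is contained in `vN(R, K)`. -/
theorem mul_privProj_mem {A : H →L[ℂ] H} (hA : A ∈ B) :
    A * privProj R K ∈ (insert K R).centralizer.centralizer := by
  have hsa : ∀ A ∈ B, IsSelfAdjoint A →
      A * privProj R K ∈ (insert K R).centralizer.centralizer := fun A hA hAs => by
    have hAp := mul_privProj_comm hR hK hB hA
    -- (Def) keeps the conjugates of `A` in `B`, which is commutative on `S`. Since `p` commutes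
    -- with `U`, the conjugates of `A p` are the restrictions to `S` of those of `A`.
    refine mem_centralizer_of_commute_conj (star_mem_insert hR hK.isSelfAdjoint) ?_ ?_
    · rw [isSelfAdjoint_iff, star_mul, hAs.star_eq, isSelfAdjoint_privProj.star_eq, hAp]
    · intro U hU hUW
      have hUA := conj_mem hK hB hU hUW hA
      have hc := commutator_mul_privProj hR hK hB hA hUA
      rw [sub_mul, sub_eq_zero] at hc
      have hpU := privProj_mem_bicommutant hR hK.isSelfAdjoint (star U)
        (star_mem_centralizer_of_star_mem (star_mem_insert hR hK.isSelfAdjoint) hUW)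
      have hconj : U * (A * privProj R K) * star U = U * A * star U * privProj R K := by
        rw [mul_assoc _ (star U), hpU]; simp only [mul_assoc]
      have hUAp := mul_privProj_comm hR hK hB hUA
      have hpp := privProj_mul_self (R := R) (K := K)
      rw [hconj]
      calc A * privProj R K * (U * A * star U * privProj R K)
          = A * (U * A * star U) * privProj R K := by
            rw [mul_assoc A, ← mul_assoc (privProj R K), ← hUAp, mul_assoc _ (privProj R K), hpp,
              mul_assoc A]
        _ = U * A * star U * privProj R K * (A * privProj R K) := by
            rw [hc, mul_assoc _ (privProj R K), ← mul_assoc (privProj R K), ← hAp,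
              mul_assoc A (privProj R K), hpp, mul_assoc _ A]
  have h1 := hsa (realPart A : H →L[ℂ] H) (by
      rw [realPart_apply_coe, ← Complex.coe_smul]
      exact B.smul_mem (add_mem hA (star_mem hA)) _) (realPart A).2
  have h2 := hsa (imaginaryPart A : H →L[ℂ] H) (by
      rw [imaginaryPart_apply_coe, ← Complex.coe_smul]
      exact B.smul_mem (B.smul_mem (sub_mem hA (star_mem hA)) _) _) (imaginaryPart A).2
  rw [← realPart_add_I_smul_imaginaryPart A, add_mul, smul_mul_assoc]
  exact Set.add_mem_centralizer h1 fun T hT => by rw [mul_smul_comm, smul_mul_assoc, h2 T hT]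

end Necessary
end BeableAlgebra

namespace BeableAlgebra

/-! ### Beable algebras from commutative quotients -/

section Quotient

open MeasureTheory WeakDual

variable {𝔄 : Type*} [CStarAlgebra 𝔄]

/-- If a state of `B` factors through a ⋆-homomorphism of `B` to a commutative C⋆-algebra, then `B`
is beable for it. -/
theorem isBeable_of_starAlgHom {D : Type*} [CommCStarAlgebra D] {B : StarSubalgebra ℂ 𝔄}
    {ρ : 𝔄 → ℂ} (γ : B →⋆ₐ[ℂ] D) (hγ : Continuous γ) {φ : D →ₗ[ℂ] ℂ}
    (hpos : ∀ a, 0 ≤ φ (star a * a)) (h1 : φ 1 = 1) (hρ : ∀ A : B, ρ A = φ (γ A)) :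
    IsBeable ρ B := by
  let : MeasurableSpace (characterSpace ℂ D) := borel _
  have : BorelSpace (characterSpace ℂ D) := ⟨rfl⟩
  have : BorelSpace (dispersionFreeStates B) := ⟨rfl⟩
  obtain ⟨μ, hμ, hφ⟩ := exists_measure_characterSpace hpos h1
  let γL : B →L[ℂ] D := ⟨γ.toAlgHom.toLinearMap, hγ⟩
  -- Pulling characters back along `γ` gives dispersion-free states of `B`; the required measure is
  -- the image under this map.
  let ψ : characterSpace ℂ D → dispersionFreeStates B := fun χ =>
    ⟨StrongDual.toWeakDual ((CharacterSpace.toCLM χ).comp γL), by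
      refine ⟨fun A => ?_, ?_, fun A X => ?_⟩
      · change 0 ≤ χ (γ (star A * A))
        rw [map_mul, map_star, map_mul, map_star]
        exact star_mul_self_nonneg _
      · change χ (γ 1) = 1
        rw [map_one, map_one]
      · change χ (γ (A * X)) = χ (γ A) * χ (γ X)
        rw [map_mul, map_mul]⟩
  have hψ : Continuous ψ := Continuous.subtype_mk
    (WeakDual.continuous_of_continuous_eval fun A =>
      (WeakDual.eval_continuous (γ A)).comp continuous_subtype_val) _
  refine ⟨μ.map ψ, Measure.isProbabilityMeasure_map hψ.measurable.aemeasurable, fun A => ?_⟩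
  rw [integral_map hψ.measurable.aemeasurable, hρ, hφ]
  · rfl
  · have hc : Continuous fun ω : dispersionFreeStates B => (ω : WeakDual ℂ B) A :=
      (WeakDual.eval_continuous A).comp continuous_subtype_val
    exact hc.measurable.aestronglyMeasurable

/-- A closed commutative ⋆-subalgebra is a commutative C⋆-algebra. -/
noncomputable abbrev commCStarAlgebraOfComm (D : StarSubalgebra ℂ 𝔄) (hD : IsClosed (D : Set 𝔄))
    (hcomm : ∀ A ∈ D, ∀ X ∈ D, A * X = X * A) : CommCStarAlgebra D :=
  have : IsClosed (D : Set 𝔄) := hD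
  { StarSubalgebra.cstarAlgebra D with
    mul_comm := fun A X => Subtype.ext (hcomm A A.2 X X.2) }

/-- If a state factors through a linear map that is a ⋆-homomorphism of `B` to a closed commutative
⋆-algebra, then `B` is beable for it. -/
theorem isBeable_of_comm {𝔅 : Type*} [CStarAlgebra 𝔅] {D : StarSubalgebra ℂ 𝔅}
    (hD : IsClosed (D : Set 𝔅)) (hcomm : ∀ A ∈ D, ∀ X ∈ D, A * X = X * A)
    {B : StarSubalgebra ℂ 𝔄} {ρ : 𝔄 → ℂ} {γ : 𝔄 → 𝔅} (hγ : Continuous γ)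
    (hγD : ∀ A ∈ B, γ A ∈ D) (hγ1 : γ 1 = 1) (hγadd : ∀ A X, γ (A + X) = γ A + γ X)
    (hγsmul : ∀ (c : ℂ) A, γ (c • A) = c • γ A) (hγstar : ∀ A, γ (star A) = star (γ A))
    (hγmul : ∀ A ∈ B, ∀ X ∈ B, γ (A * X) = γ A * γ X) {φ : 𝔅 → ℂ}
    (hφadd : ∀ a b, φ (a + b) = φ a + φ b) (hφsmul : ∀ (c : ℂ) a, φ (c • a) = c * φ a)
    (hpos : ∀ a, 0 ≤ φ (star a * a)) (h1 : φ 1 = 1) (hρ : ∀ A ∈ B, ρ A = φ (γ A)) :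
    IsBeable ρ B := by
  let : CommCStarAlgebra D := commCStarAlgebraOfComm D hD hcomm
  let γ' : B →⋆ₐ[ℂ] D :=
    { toFun := fun A => ⟨γ A, hγD A A.2⟩
      map_one' := Subtype.ext hγ1
      map_mul' := fun A X => Subtype.ext (hγmul A A.2 X X.2)
      map_zero' := Subtype.ext (by simpa using hγsmul 0 0)
      map_add' := fun A X => Subtype.ext (hγadd A X)
      commutes' := fun c => Subtype.ext (by
        change γ (algebraMap ℂ 𝔄 c) = algebraMap ℂ 𝔅 c
        rw [Algebra.algebraMap_eq_smul_one, hγsmul, hγ1, Algebra.algebraMap_eq_smul_one])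
      map_star' := fun A => Subtype.ext (hγstar A) }
  let φ' : D →ₗ[ℂ] ℂ :=
    { toFun := fun a => φ a
      map_add' := fun a b => hφadd a b
      map_smul' := fun c a => hφsmul c a }
  exact isBeable_of_starAlgHom (φ := φ') γ'
    (Continuous.subtype_mk (hγ.comp continuous_subtype_val) _) (fun a => hpos a) h1
    fun A => hρ A A.2

variable {e : 𝔄} {M : NonUnitalStarSubalgebra ℂ 𝔄}

/-- The operators reduced by a projection `e` whose restriction to `e` belongs to `M`. -/
def reducedSum (e : 𝔄) (M : NonUnitalStarSubalgebra ℂ 𝔄) (hes : IsSelfAdjoint e)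
    (hee : e * e = e) (heM : e ∈ M) :
    StarSubalgebra ℂ 𝔄 where
  carrier := {X | X * e = e * X ∧ X * e ∈ M}
  mul_mem' := fun {X Y} ⟨hX, hXM⟩ ⟨hY, hYM⟩ => by
    have h : X * Y * e = X * e * (Y * e) := by
      rw [mul_assoc X e, ← mul_assoc e, ← hY, mul_assoc Y, hee, mul_assoc]
    refine ⟨by rw [mul_assoc, hY, ← mul_assoc, hX, mul_assoc], ?_⟩
    rw [h]
    exact mul_mem hXM hYM
  add_mem' := fun {X Y} ⟨hX, hXM⟩ ⟨hY, hYM⟩ =>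
    ⟨by rw [add_mul, mul_add, hX, hY], by rw [add_mul]; exact add_mem hXM hYM⟩
  algebraMap_mem' := fun c => by
    refine ⟨Algebra.commutes c e, ?_⟩
    rw [Algebra.algebraMap_eq_smul_one, smul_mul_assoc, one_mul]
    exact M.smul_mem' c heM
  star_mem' := fun {X} ⟨hX, hXM⟩ => by
    have h := congr_arg star hX
    rw [star_mul, star_mul, hes.star_eq] at h
    refine ⟨h.symm, ?_⟩
    rw [← h, ← hes.star_eq, ← star_mul]
    exact star_mem hXM

theorem isClosed_reducedSum {hes : IsSelfAdjoint e} {hee : e * e = e} {heM : e ∈ M}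
    (hM : IsClosed (M : Set 𝔄)) : IsClosed (reducedSum e M hes hee heM : Set 𝔄) :=
  (isClosed_eq (continuous_id.mul continuous_const) (continuous_const.mul continuous_id)).inter
    (hM.preimage (continuous_id.mul continuous_const))

/-- Maximal abelian ⋆-subalgebras of a closed algebra are closed. -/
theorem isClosed_of_maximal_abelian {C : NonUnitalStarSubalgebra ℂ 𝔄} (hC : IsClosed (C : Set 𝔄))
    (hM : Maximal (fun N : NonUnitalStarSubalgebra ℂ 𝔄 =>
      (N : Set 𝔄) ⊆ C ∧ ∀ A ∈ N, ∀ B ∈ N, A * B = B * A) M) : IsClosed (M : Set 𝔄) := by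
  -- Maximality identifies `M` with its relative commutant in `C`, which is visibly closed.
  have h : (M : Set 𝔄) = (C : Set 𝔄) ∩ Set.centralizer (M : Set 𝔄) := Set.Subset.antisymm
    (fun X hX => ⟨hM.prop.1 hX, fun A hA => hM.prop.2 A hA X hX⟩)
    fun X hX => mem_of_maximal_abelian hM hX.1 hX.2
  rw [h]
  exact hC.inter (Set.isClosed_centralizer _)

end Quotient

/-! ### Compression to a subspace -/

section Compression

open ContinuousLinearMap

variable {H : Type*} [NormedAddCommGroup H] [InnerProductSpace ℂ H]
variable (Y : Submodule ℂ H) [CompleteSpace Y]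

/-- The operator on `H` that extends an operator on `Y` by `0`. -/
noncomputable def extend (T : Y →L[ℂ] Y) : H →L[ℂ] H :=
  Y.subtypeL ∘L T ∘L Y.orthogonalProjectionOnto

/-- The compression to `Y` of an operator on `H`. -/
noncomputable def compress (A : H →L[ℂ] H) : Y →L[ℂ] Y :=
  Y.orthogonalProjectionOnto ∘L A ∘L Y.subtypeL

theorem extend_apply (T : Y →L[ℂ] Y) (x : H) :
    extend Y T x = T (Y.orthogonalProjectionOnto x) := rfl

theorem compress_apply (A : H →L[ℂ] H) (y : Y) :
    compress Y A y = Y.orthogonalProjectionOnto (A y) := rfl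

theorem extend_add (T T' : Y →L[ℂ] Y) : extend Y (T + T') = extend Y T + extend Y T' := by
  ext x
  simp [extend_apply]

theorem extend_smul (c : ℂ) (T : Y →L[ℂ] Y) : extend Y (c • T) = c • extend Y T := by
  ext x
  simp [extend_apply]

theorem extend_mul (T T' : Y →L[ℂ] Y) : extend Y (T * T') = extend Y T * extend Y T' := by
  ext x
  simp [extend_apply]

theorem extend_one : extend Y 1 = Y.starProjection := rfl

theorem extend_star [CompleteSpace H] (T : Y →L[ℂ] Y) : extend Y (star T) = star (extend Y T) := by
  simp only [extend, star_eq_adjoint, adjoint_comp, Submodule.adjoint_subtypeL,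
    Submodule.adjoint_orthogonalProjectionOnto]
  rfl

theorem extend_injective : Function.Injective (extend Y) := fun T T' h => by
  ext y
  have := DFunLike.congr_fun h (y : H)
  simpa [extend_apply] using this

theorem extend_compress (A : H →L[ℂ] H) :
    extend Y (compress Y A) = Y.starProjection * A * Y.starProjection := rfl

theorem compress_one : compress Y (1 : H →L[ℂ] H) = 1 := by
  ext y
  simp [compress_apply]

theorem compress_add (A X : H →L[ℂ] H) :
    compress Y (A + X) = compress Y A + compress Y X := by
  ext y
  simp [compress_apply]

theorem compress_smul (c : ℂ) (A : H →L[ℂ] H) : compress Y (c • A) = c • compress Y A := by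
  ext y
  simp [compress_apply]

theorem compress_star [CompleteSpace H] (A : H →L[ℂ] H) :
    compress Y (star A) = star (compress Y A) := by
  simp only [compress, star_eq_adjoint, adjoint_comp, Submodule.adjoint_subtypeL,
    Submodule.adjoint_orthogonalProjectionOnto]
  rfl

/-- One factor reduced by `Y` is enough, so compression is a homomorphism on operators commuting
with the projection. -/
theorem compress_mul {A : H →L[ℂ] H} (hA : A * Y.starProjection = Y.starProjection * A)
    (X : H →L[ℂ] H) : compress Y (A * X) = compress Y A * compress Y X := by
  have hee : Y.starProjection * Y.starProjection = Y.starProjection :=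
    (Submodule.isIdempotentElem_starProjection _).eq
  refine extend_injective Y ?_
  rw [extend_mul, extend_compress, extend_compress, extend_compress, ← hA, ← mul_assoc, ← hA,
    mul_assoc A Y.starProjection Y.starProjection, hee, mul_assoc Y.starProjection X,
    ← mul_assoc (A * Y.starProjection), mul_assoc A Y.starProjection Y.starProjection, hee,
    mul_assoc (A * Y.starProjection)]

theorem continuous_extend : Continuous (extend Y) := by
  unfold extend; fun_prop

theorem continuous_compress : Continuous (compress Y) := by
  unfold compress; fun_prop

end Compression
end BeableAlgebra

namespace BeableAlgebra

variable {H : Type*} [NormedAddCommGroup H] [InnerProductSpace ℂ H] [CompleteSpace H]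

/-! ### Beability through compression to a corner -/

section Corner

variable (Y : Submodule ℂ H) [CompleteSpace Y] {M : NonUnitalStarSubalgebra ℂ (H →L[ℂ] H)}

/-- The operators on `Y` whose extensions by `0` belong to `M`. -/
def corner (M : NonUnitalStarSubalgebra ℂ (H →L[ℂ] H)) (hY : Y.starProjection ∈ M) :
    StarSubalgebra ℂ (Y →L[ℂ] Y) where
  carrier := {T | extend Y T ∈ M}
  mul_mem' := fun {T T'} hT hT' => by
    change extend Y (T * T') ∈ M
    rw [extend_mul]; exact mul_mem hT hT'
  add_mem' := fun {T T'} hT hT' => by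
    change extend Y (T + T') ∈ M
    rw [extend_add]; exact add_mem hT hT'
  algebraMap_mem' := fun c => by
    change extend Y (c • 1) ∈ M
    rw [extend_smul]; exact M.smul_mem' c hY
  star_mem' := fun {T} hT => by
    change extend Y (star T) ∈ M
    rw [extend_star]; exact star_mem hT

theorem isClosed_corner {hY : Y.starProjection ∈ M} (hM : IsClosed (M : Set (H →L[ℂ] H))) :
    IsClosed (corner Y M hY : Set (Y →L[ℂ] Y)) := hM.preimage (continuous_extend Y)

theorem corner_comm {hY : Y.starProjection ∈ M} (hM : ∀ A ∈ M, ∀ B ∈ M, A * B = B * A) :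
    ∀ A ∈ corner Y M hY, ∀ X ∈ corner Y M hY, A * X = X * A := fun A hA X hX =>
  extend_injective Y (by rw [extend_mul, extend_mul]; exact hM _ hA _ hX)

-- The unit of `M` is the projection `e` onto `Y` rather than `1`, so `M` is regarded as a unital
-- commutative C⋆-algebra on `Y`. The state factors through the compression since `K e = K` gives
-- `ρ(A) = ρ(e A)`, and `e A = A e` for reduced `A`.
variable {Y} in
theorem isBeable_reducedSum {K : H →L[ℂ] H} (hK : IsDensityOperator K)
    (hKY : K * Y.starProjection = K) (hM : IsClosed (M : Set (H →L[ℂ] H)))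
    (hcomm : ∀ A ∈ M, ∀ B ∈ M, A * B = B * A) (hes : IsSelfAdjoint Y.starProjection)
    (hee : Y.starProjection * Y.starProjection = Y.starProjection) (hY : Y.starProjection ∈ M) :
    IsBeable (normalState K) (reducedSum Y.starProjection M hes hee hY) := by
  have hAp : ∀ A : H →L[ℂ] H, A * Y.starProjection = Y.starProjection * A →
      extend Y (compress Y A) = A * Y.starProjection := fun A hA => by
    rw [extend_compress, ← hA, mul_assoc, hee]
  refine isBeable_of_comm (D := corner Y M hY) (γ := compress Y)
    (φ := fun T => normalState K (extend Y T)) (isClosed_corner Y hM) (corner_comm Y hcomm)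
    (continuous_compress Y) (fun A hA => ?_) (compress_one Y) (compress_add Y) (compress_smul Y)
    (compress_star Y) (fun A hA X _ => compress_mul Y hA.1 X) (fun T T' => ?_) (fun c T => ?_)
    (fun T => ?_) ?_ fun A hA => ?_
  · change extend Y (compress Y A) ∈ M
    rw [hAp A hA.1]
    exact hA.2
  · simp only [extend_add, normalState_add hK]
  · simp only [extend_smul, normalState_smul hK]
  · simp only [extend_mul, extend_star]
    exact normalState_star_mul_self_nonneg hK _
  · simp only [extend_one, normalState, hKY]
    exact hK.2
  · simp only [hAp A hA.1, hA.1, normalState]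
    rw [← mul_assoc, hKY]

end Corner
end BeableAlgebra

namespace BeableAlgebra

/-! ### The algebras `L(S^⊥) ⊕ M` -/

/-- The restriction `B e` of `B` to a projection `e` that commutes with `B`. -/
def restriction {𝔄 : Type*} [CStarAlgebra 𝔄] (B : StarSubalgebra ℂ 𝔄) (e : 𝔄)
    (hes : IsSelfAdjoint e) (hee : e * e = e) (he : ∀ X ∈ B, X * e = e * X) :
    NonUnitalStarSubalgebra ℂ 𝔄 where
  carrier := (fun A => A * e) '' (B : Set 𝔄)
  add_mem' := by
    rintro _ _ ⟨A, hA, rfl⟩ ⟨X, hX, rfl⟩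
    exact ⟨A + X, add_mem hA hX, add_mul _ _ _⟩
  zero_mem' := ⟨0, zero_mem B, zero_mul e⟩
  mul_mem' := by
    rintro _ _ ⟨A, hA, rfl⟩ ⟨X, hX, rfl⟩
    refine ⟨A * X, mul_mem hA hX, ?_⟩
    simp only
    rw [mul_assoc A e, ← mul_assoc e, ← he X hX, mul_assoc X, hee, mul_assoc]
  smul_mem' := by
    rintro c _ ⟨A, hA, rfl⟩
    exact ⟨c • A, B.smul_mem hA c, smul_mul_assoc _ _ _⟩
  star_mem' := by
    rintro _ ⟨A, hA, rfl⟩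
    exact ⟨star A, star_mem hA, by simp only [he _ (star_mem hA), star_mul, hes.star_eq]⟩

variable {H : Type*} [NormedAddCommGroup H] [InnerProductSpace ℂ H] [CompleteSpace H]
variable {R : Set (H →L[ℂ] H)} {K : H →L[ℂ] H} {M : NonUnitalStarSubalgebra ℂ (H →L[ℂ] H)}
  {B : StarSubalgebra ℂ (H →L[ℂ] H)}

/-- `vN(R, K) P_S` as an algebra. -/
noncomputable def reducedVN (hR : ∀ A ∈ R, IsSelfAdjoint A) (hK : IsSelfAdjoint K) :
    NonUnitalStarSubalgebra ℂ (H →L[ℂ] H) :=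
  reducedAlgebra (bicommutant (insert K R)).toStarSubalgebra (privProj R K) isSelfAdjoint_privProj
    fun X hX => by
      have hX' : X ∈ (bicommutant (insert K R) : Set (H →L[ℂ] H)) := hX
      rw [coe_bicommutant (star_mem_insert hR hK)] at hX'
      exact (hX' _ (privProj_mem_centralizer hR hK)).symm

theorem mem_reducedVN {hR : ∀ A ∈ R, IsSelfAdjoint A} {hK : IsSelfAdjoint K} {X : H →L[ℂ] H} :
    X ∈ reducedVN hR hK ↔
      X ∈ (insert K R).centralizer.centralizer ∧ X * privProj R K = X := by
  rw [← coe_bicommutant (star_mem_insert hR hK)]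
  rfl

theorem coe_reducedVN (hR : ∀ A ∈ R, IsSelfAdjoint A) (hK : IsSelfAdjoint K) :
    (reducedVN hR hK : Set (H →L[ℂ] H)) = (fun A => A * privProj R K) '' vN (insert K R) := by
  rw [vN_eq (star_mem_insert hR hK), ← coe_bicommutant (star_mem_insert hR hK)]
  refine coe_reducedAlgebra ?_ privProj_mul_self
  change privProj R K ∈ (bicommutant (insert K R) : Set (H →L[ℂ] H))
  rw [coe_bicommutant (star_mem_insert hR hK)]
  exact privProj_mem_bicommutant hR hK

theorem isClosed_reducedVN (hR : ∀ A ∈ R, IsSelfAdjoint A) (hK : IsSelfAdjoint K) :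
    IsClosed (reducedVN hR hK : Set (H →L[ℂ] H)) := by
  have h : (reducedVN hR hK : Set (H →L[ℂ] H)) =
      (insert K R).centralizer.centralizer ∩ {X | X * privProj R K = X} :=
    Set.ext fun X => mem_reducedVN
  rw [h]
  exact (Set.isClosed_centralizer _).inter
    (isClosed_eq (continuous_id.mul continuous_const) continuous_id)

theorem isMaximalAbelianIn_iff (hR : ∀ A ∈ R, IsSelfAdjoint A) (hK : IsSelfAdjoint K) :
    IsMaximalAbelianIn ((fun A => A * privProj R K) '' vN (insert K R)) M ↔
      Maximal (fun N : NonUnitalStarSubalgebra ℂ (H →L[ℂ] H) =>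
        (N : Set (H →L[ℂ] H)) ⊆ reducedVN hR hK ∧ ∀ A ∈ N, ∀ B ∈ N, A * B = B * A) M := by
  rw [coe_reducedVN]; rfl

theorem IsAdmissible.privProj_mem (hM : IsAdmissible R K M) : privProj R K ∈ M :=
  hM.lower ⟨1, Set.mem_iInter₂.2 fun V _ => one_mem V, one_mul _⟩

theorem mul_privProj_of_mem_vN (hR : ∀ A ∈ R, IsSelfAdjoint A) (hK : IsSelfAdjoint K)
    {A : H →L[ℂ] H} (hA : A ∈ (fun A => A * privProj R K) '' vN (insert K R)) :
    A ∈ (insert K R).centralizer.centralizer ∧ A * privProj R K = A ∧ privProj R K * A = A := by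
  rw [← coe_reducedVN hR hK] at hA
  obtain ⟨h1, h2⟩ := mem_reducedVN.1 hA
  exact ⟨h1, h2, by rw [h1 _ (privProj_mem_centralizer hR hK), h2]⟩

theorem coe_reducedSum (hR : ∀ A ∈ R, IsSelfAdjoint A) (hK : IsSelfAdjoint K)
    (hM : IsAdmissible R K M) :
    (reducedSum (privProj R K) M isSelfAdjoint_privProj privProj_mul_self hM.privProj_mem :
      Set (H →L[ℂ] H)) = directSum R K M := by
  have hpp := privProj_mul_self (R := R) (K := K)
  ext X
  constructor
  · rintro ⟨hX, hXM⟩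
    refine ⟨X, X * privProj R K, hXM, ?_⟩
    rw [mul_sub, mul_one, sub_mul, sub_mul, one_mul, mul_assoc _ X, hX, ← mul_assoc, hpp]
    abel
  · rintro ⟨C, A, hA, rfl⟩
    obtain ⟨-, h1, h2⟩ := mul_privProj_of_mem_vN hR hK (hM.upper hA)
    have e1 : ((1 - privProj R K) * C * (1 - privProj R K) + A) * privProj R K = A := by
      have hqp : (1 - privProj R K) * privProj R K = 0 := by rw [sub_mul, one_mul, hpp, sub_self]
      rw [add_mul, mul_assoc _ _ (privProj R K), hqp, mul_zero, zero_add, h1]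
    have e2 : privProj R K * ((1 - privProj R K) * C * (1 - privProj R K) + A) = A := by
      have hpq : privProj R K * (1 - privProj R K) = 0 := by rw [mul_sub, mul_one, hpp, sub_self]
      rw [mul_add, ← mul_assoc, ← mul_assoc, hpq, zero_mul, zero_mul, zero_add, h2]
    exact ⟨e1.trans e2.symm, by rwa [e1]⟩

/-- The algebras `L(S^⊥) ⊕ M` are `R`-beable. -/
theorem isRBeable_reducedSum (hR : ∀ A ∈ R, IsSelfAdjoint A) (hK : IsDensityOperator K)
    (hM : IsAdmissible R K M) :
    IsRBeable R (normalState K) (reducedSum (privProj R K) M isSelfAdjoint_privProj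
      privProj_mul_self hM.privProj_mem) := by
  have hKs := hK.isSelfAdjoint
  have hMmax := (isMaximalAbelianIn_iff hR hKs).1 hM.maximalAbelian
  have hMc : IsClosed (M : Set (H →L[ℂ] H)) :=
    isClosed_of_maximal_abelian (isClosed_reducedVN hR hKs) hMmax
  have hpR := privProj_mem_centralizer hR hKs
  have hpW := privProj_mem_bicommutant hR hKs
  refine ⟨isClosed_reducedSum hMc, ?_, fun A hA => ?_, fun U hU hUR hUρ => ?_⟩
  · exact isBeable_reducedSum hK (mul_privProj hKs) hMc hMmax.prop.2 _ _ hM.privProj_mem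
  · refine ⟨hpR A (Set.mem_insert_of_mem _ hA), hM.lower ⟨A, ?_, rfl⟩⟩
    exact Set.mem_iInter₂.2 fun V hV => hV hA
  · have hUW : U ∈ (insert K R).centralizer := by
      rintro A (rfl | hA)
      · exact (commute_of_normalState_conj hK hU hUρ).symm
      · exact hUR A hA
    have hU'W := star_mem_centralizer_of_star_mem (star_mem_insert hR hKs) hUW
    -- Conjugation by `V` fixes the part on `S`, because `X p ∈ M` lies in the double commutant; the
    -- part on `S^⊥` is unrestricted. Using both `U` and `star U` yields equality of the sets.
    have key : ∀ V ∈ unitary (H →L[ℂ] H), V ∈ (insert K R).centralizer →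
        star V ∈ (insert K R).centralizer → ∀ X, X * privProj R K = privProj R K * X →
        X * privProj R K ∈ M → V * X * star V * privProj R K =
          privProj R K * (V * X * star V) ∧ V * X * star V * privProj R K ∈ M := by
      intro V hV hVW hV'W X hX hXM
      have h1 : V * X * star V * privProj R K = X * privProj R K := by
        rw [mul_assoc, hpW _ hV'W, ← mul_assoc, mul_assoc V X,
          (mul_privProj_of_mem_vN hR hKs (hM.upper hXM)).1 V hVW, mul_assoc,
          (Unitary.mem_iff.1 hV).2, mul_one]
      have h2 : privProj R K * (V * X * star V) = X * privProj R K := by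
        rw [← h1, ← mul_assoc, ← mul_assoc, ← hpW V hVW, mul_assoc V, ← hX, mul_assoc _ (star V),
          hpW _ hV'W]
        simp only [mul_assoc]
      exact ⟨h1.trans h2.symm, by rwa [h1]⟩
    refine Set.Subset.antisymm ?_ fun X hX => ?_
    · rintro _ ⟨X, hX, rfl⟩
      exact key U hU hUW hU'W X hX.1 hX.2
    · refine ⟨star U * X * U, ?_, ?_⟩
      · have := key (star U) (Unitary.star_mem hU) hU'W (by rwa [star_star]) X hX.1 hX.2
        rwa [star_star] at this
      · simp only [mul_assoc, (Unitary.mem_iff.1 hU).2, mul_one]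
        rw [← mul_assoc, (Unitary.mem_iff.1 hU).2, one_mul]

/-! ### Restrictions of `R`-beable algebras and admissibility -/

section Restriction

variable (hR : ∀ A ∈ R, IsSelfAdjoint A) (hK : IsDensityOperator K)
  (hB : IsRBeable R (normalState K) B)

/-- The restriction of an `R`-beable algebra to `S`. -/
noncomputable def privRestriction : NonUnitalStarSubalgebra ℂ (H →L[ℂ] H) :=
  restriction B (privProj R K) isSelfAdjoint_privProj privProj_mul_self
    fun _ hX => mul_privProj_comm hR hK hB hX

theorem mem_privRestriction {A : H →L[ℂ] H} (hA : A ∈ B) :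
    A * privProj R K ∈ privRestriction hR hK hB := ⟨A, hA, rfl⟩

theorem privRestriction_abelian :
    (privRestriction hR hK hB : Set (H →L[ℂ] H)) ⊆ reducedVN hR hK.isSelfAdjoint ∧
      ∀ A ∈ privRestriction hR hK hB, ∀ X ∈ privRestriction hR hK hB, A * X = X * A := by
  have hpp := privProj_mul_self (R := R) (K := K)
  constructor
  · rintro _ ⟨A, hA, rfl⟩
    exact mem_reducedVN.2 ⟨mul_privProj_mem hR hK hB hA, by simp only [mul_assoc, hpp]⟩
  · rintro _ ⟨A, hA, rfl⟩ _ ⟨X, hX, rfl⟩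
    have h := commutator_mul_privProj hR hK hB hA hX
    rw [sub_mul, sub_eq_zero] at h
    have e : ∀ A X : H →L[ℂ] H, X * privProj R K = privProj R K * X →
        A * privProj R K * (X * privProj R K) = A * X * privProj R K := fun A X hX => by
      rw [mul_assoc A, ← mul_assoc _ X, ← hX, mul_assoc X, hpp, mul_assoc]
    simp only [e A X (mul_privProj_comm hR hK hB hX), e X A (mul_privProj_comm hR hK hB hA), h]

theorem le_reducedSum (hpM : privProj R K ∈ M) (h : privRestriction hR hK hB ≤ M) :
    B ≤ reducedSum (privProj R K) M isSelfAdjoint_privProj privProj_mul_self hpM :=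
  fun _ hA => ⟨mul_privProj_comm hR hK hB hA, h (mem_privRestriction hR hK hB hA)⟩

include hR hK hB

/-- A maximal abelian subalgebra of `vN(R, K) P_S` that contains the restriction of an `R`-beable
algebra is admissible. -/
theorem isAdmissible_of_privRestriction_le (h : privRestriction hR hK hB ≤ M)
    (hM : IsMaximalAbelianIn ((fun A => A * privProj R K) '' vN (insert K R)) M) :
    IsAdmissible R K M := by
  have hKs := hK.isSelfAdjoint
  refine ⟨?_, hM.prop.1, hM⟩
  rintro _ ⟨A, hA, rfl⟩
  have hAW : A * privProj R K ∈ reducedVN hR hKs := by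
    rw [← SetLike.mem_coe, coe_reducedVN]
    refine ⟨A, Set.mem_iInter₂.2 fun V hV => ?_, rfl⟩
    exact Set.mem_iInter₂.1 hA V ((Set.subset_insert K R).trans hV)
  refine mem_of_maximal_abelian ((isMaximalAbelianIn_iff hR hKs).1 hM) hAW fun X hX => ?_
  obtain ⟨-, h1, h2⟩ := mul_privProj_of_mem_vN hR hKs (hM.prop.1 hX)
  -- `M` contains `T p` for every `T ∈ R`, so its elements commute with `R` and hence with `vN(R)`.
  -- Maximality then puts `vN(R) P_S` into `M`.
  have hXR : X ∈ R.centralizer := fun T hT => by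
    have hc := hM.prop.2 _ (h (mem_privRestriction hR hK hB (hB.priv hT))) X hX
    have hTp := privProj_mem_centralizer hR hKs T (Set.mem_insert_of_mem _ hT)
    rwa [mul_assoc, h2, hTp, ← mul_assoc, h1] at hc
  rw [vN_eq fun T hT => by rwa [(hR T hT).star_eq]] at hA
  rw [← mul_assoc, hA X hXR, mul_assoc, h1, mul_assoc, h2]

end Restriction

end BeableAlgebra

/-! ### The structure theorem -/

theorem mainTheorem2 {H : Type*} [NormedAddCommGroup H] [InnerProductSpace ℂ H] [CompleteSpace H]
    (R : Set (H →L[ℂ] H)) (hR : ∀ A ∈ R, IsSelfAdjoint A)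
    (hcomm : ∀ A ∈ R, ∀ B ∈ R, A * B = B * A)
    (K : H →L[ℂ] H) (hK : BeableAlgebra.IsDensityOperator K) :
    IsLeast {Y : Submodule ℂ H | IsClosed (Y : Set H) ∧ Set.range K ⊆ Y ∧
        ∀ A ∈ R, ∀ y ∈ Y, A y ∈ Y} (BeableAlgebra.privSubspace R K) ∧
    (∀ B : StarSubalgebra ℂ (H →L[ℂ] H),
      BeableAlgebra.IsMaximalRBeable R (BeableAlgebra.normalState K) B →
      ∃ M : NonUnitalStarSubalgebra ℂ (H →L[ℂ] H), BeableAlgebra.IsAdmissible R K M ∧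
        (B : Set (H →L[ℂ] H)) = BeableAlgebra.directSum R K M) ∧
    (∀ M : NonUnitalStarSubalgebra ℂ (H →L[ℂ] H), BeableAlgebra.IsAdmissible R K M →
      ∃ B : StarSubalgebra ℂ (H →L[ℂ] H),
        (B : Set (H →L[ℂ] H)) = BeableAlgebra.directSum R K M ∧
        BeableAlgebra.IsMaximalRBeable R (BeableAlgebra.normalState K) B) := by
  open BeableAlgebra in
  have hKs := hK.isSelfAdjoint
  refine ⟨isLeast_privSubspace hR, fun B hB => ?_, fun M hM => ?_⟩
  · obtain ⟨M, hBM, hM⟩ := exists_maximal_abelian (privRestriction_abelian hR hK hB.prop)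
    have hadm := isAdmissible_of_privRestriction_le hR hK hB.prop hBM
      ((isMaximalAbelianIn_iff hR hKs).2 hM)
    refine ⟨M, hadm, ?_⟩
    rw [← coe_reducedSum hR hKs hadm]
    have hle := le_reducedSum hR hK hB.prop hadm.privProj_mem hBM
    -- `B` sits inside an `R`-beable algebra, so its maximality gives equality.
    exact congr_arg _ (hle.antisymm (hB.le_of_ge (isRBeable_reducedSum hR hK hadm) hle))
  · refine ⟨_, coe_reducedSum hR hKs hM, isRBeable_reducedSum hR hK hM, fun B hB hMB => ?_⟩
    have hMmax := (isMaximalAbelianIn_iff hR hKs).1 hM.maximalAbelian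
    refine le_reducedSum hR hK hB hM.privProj_mem ?_
    -- A larger `R`-beable `B` restricts to an abelian algebra containing `M`; maximality of `M`
    -- bounds this restriction by `M`, and there is no room left on `S^⊥`.
    refine hMmax.le_of_ge (privRestriction_abelian hR hK hB) fun X hX => ?_
    obtain ⟨-, h1, h2⟩ := mul_privProj_of_mem_vN hR hKs (hM.upper hX)
    have hXB : X ∈ B := hMB ⟨h1.trans h2.symm, by rwa [h1]⟩
    rw [← h1]
    exact mem_privRestriction hR hK hB hXB
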